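/- Let $k$ be a field and write $R=k[s,s^{-1}]$. A \emph{prop} is a strict symmetric monoidal category whose objects are the natural numbers, with monoidal product on objects given by addition; homomorphisms of props are identity-on-objects strict symmetric monoidal functors. The indeterminate $s$ acts on a biinfinite stream $w\in k^{\mathbb Z}$ by $(s\cdot w)(t)=w(t-1)$ and $s^{-1}$ by $(s^{-1}\cdot w)(t)=w(t+1)$; extending linearly to Laurent polynomials, every $n\times m$ matrix $M$ over $R$ induces a $k$-linear map $\theta M\colon (k^m)^{\mathbb Z}\to(k^n)^{\mathbb Z}$. Let $\mathsf{Mat}\,R$ be the prop whose arrows $m\to n$ are the $n\times m$ matrices over $R$, with matrix multiplication as composition, block-diagonal matrices as monoidal product, and permutation matrices as symmetries. Let $\mathsf{Corel}(\mathsf{Mat}\,R)$ be the prop whose arrows $m\to n$ are the isomorphism classes of cospans $m\xrightarrow{A}d\xleftarrow{B}n$ of matrices over $R$ ($A$ of size $d\times m$, $B$ of size $d\times n$) that are jointly epic, that is, such that $[A\ \ B]\colon m+n\to d$ is an epimorphism in $\mathsf{Mat}\,R$. Two corelations are composed by taking the pushout of their inner legs in $\mathsf{Mat}\,R$, factorising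 the copairing of the resulting cospan as an epimorphism followed by a split monomorphism, and keeping the epimorphism; the monoidal product is the direct sum of cospans, and the identities and symmetries are those of $\mathsf{Mat}\,R$, a matrix $A\colon m\to n$ being viewed as the corelation $m\xrightarrow{A}n\xleftarrow{1}n$. Let $\mathsf{LTI}$ be the prop whose arrows $m\to n$ are the complete linear time-invariant behaviours with domain $(k^m)^{\mathbb Z}$ and codomain $(k^n)^{\mathbb Z}$: the $k$-linear subspaces $\mathcal B\subseteq(k^m)^{\mathbb Z}\oplus(k^n)^{\mathbb Z}$ such that $w\in\mathcal B$ implies $w(\cdot+i)\in\mathcal B$ for all $i\in\mathbb Z$, and such that every $w$ whose restriction to each interval $[t_0,t_1]$, with $t_0\le t_1$ in $\mathbb Z$, is the restriction of some element of $\mathcal B$ itself belongs to $\mathcal B$. Composition in $\mathsf{LTI}$ is relational composition, the monoidal product is direct sum, and the identities and symmetries are the relations $\{(x,x)\}$ and $\{((x,y),(y,x))\}$. Then there is an isomorphism of props $$\Phi\colon \mathsf{Corel}(\mathsf{Mat}\,k[s,s^{-1}])\longrightarrow\mathsf{LTI}$$ which sends the class of every jointly epic cospan $m\xrightarrow{A}d\xleftarrow{B}n$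 to $$\{(x,y)\in (k^m)^{\mathbb Z}\oplus(k^n)^{\mathbb Z} \mid (\theta A)x=(\theta B)y\}=\ker\theta[A\ \ {-B}],$$ where $(k^m)^{\mathbb Z}\oplus(k^n)^{\mathbb Z}$ is identified with $(k^{m+n})^{\mathbb Z}$. -/

import Mathlib

open scoped LaurentPolynomial Matrix

namespace LTISys

universe u v

/-! ### Props -/

/-- The operations of a prop: a family of arrows indexed by pairs of natural numbers, with
identities, composition `comp f g` (first `f`, then `g`), monoidal product (addition on objects)
and symmetries. The laws are in `PROPData.IsPROP`. -/
structure PROPData where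
  Hom : ℕ → ℕ → Type u
  id (n : ℕ) : Hom n n
  comp {l m n : ℕ} (f : Hom l m) (g : Hom m n) : Hom l n
  tensor {m n m' n' : ℕ} (f : Hom m n) (g : Hom m' n') : Hom (m + m') (n + n')
  symm (m n : ℕ) : Hom (m + n) (n + m)

/-- Transport of an arrow along equalities of objects. It is needed to write the strict laws, as
for example `(a + b) + c` and `a + (b + c)` are equal but not syntactically so. -/
def PROPData.cast (P : PROPData.{u}) {m n m' n' : ℕ} (hm : m = m') (hn : n = n')
    (f : P.Hom m n) : P.Hom m' n' :=
  hn ▸ hm ▸ f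

/-- The laws of a strict symmetric monoidal category on the objects `ℕ`, where the monoidal
product is addition on objects. -/
structure PROPData.IsPROP (P : PROPData.{u}) : Prop where
  id_comp : ∀ {m n : ℕ} (f : P.Hom m n), P.comp (P.id m) f = f
  comp_id : ∀ {m n : ℕ} (f : P.Hom m n), P.comp f (P.id n) = f
  assoc : ∀ {k l m n : ℕ} (f : P.Hom k l) (g : P.Hom l m) (h : P.Hom m n),
    P.comp (P.comp f g) h = P.comp f (P.comp g h)
  tensor_id : ∀ m n : ℕ, P.tensor (P.id m) (P.id n) = P.id (m + n)
  tensor_comp : ∀ {l m n l' m' n' : ℕ} (f : P.Hom l m) (g : P.Hom m n)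
    (f' : P.Hom l' m') (g' : P.Hom m' n'),
    P.tensor (P.comp f g) (P.comp f' g') = P.comp (P.tensor f f') (P.tensor g g')
  tensor_assoc : ∀ {m n m' n' m'' n'' : ℕ} (f : P.Hom m n) (g : P.Hom m' n')
    (h : P.Hom m'' n''),
    P.cast (Nat.add_assoc m m' m'') (Nat.add_assoc n n' n'') (P.tensor (P.tensor f g) h) =
      P.tensor f (P.tensor g h)
  unit_tensor : ∀ {m n : ℕ} (f : P.Hom m n),
    P.cast (Nat.zero_add m) (Nat.zero_add n) (P.tensor (P.id 0) f) = f
  tensor_unit : ∀ {m n : ℕ} (f : P.Hom m n),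
    P.cast (Nat.add_zero m) (Nat.add_zero n) (P.tensor f (P.id 0)) = f
  symm_natural : ∀ {m n m' n' : ℕ} (f : P.Hom m n) (g : P.Hom m' n'),
    P.comp (P.tensor f g) (P.symm n n') = P.comp (P.symm m m') (P.tensor g f)
  symm_symm : ∀ m n : ℕ, P.comp (P.symm m n) (P.symm n m) = P.id (m + n)
  hexagon : ∀ m n p : ℕ,
    P.comp (P.cast rfl (Nat.add_assoc n m p) (P.tensor (P.symm m n) (P.id p)))
      (P.tensor (P.id n) (P.symm m p)) =
    P.cast (Nat.add_assoc m n p).symm (Nat.add_assoc n p m) (P.symm m (n + p))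

/-- A prop: a strict symmetric monoidal category whose objects are the natural numbers and whose
monoidal product is addition on objects. -/
structure PROP extends PROPData.{u} where
  isPROP : toPROPData.IsPROP

/-- A homomorphism of props: an identity-on-objects strict symmetric monoidal functor. -/
structure PROPHom (P : PROP.{u}) (Q : PROP.{v}) where
  map {m n : ℕ} : P.Hom m n → Q.Hom m n
  map_id : ∀ n : ℕ, map (P.id n) = Q.id n
  map_comp : ∀ {l m n : ℕ} (f : P.Hom l m) (g : P.Hom m n),
    map (P.comp f g) = Q.comp (map f) (map g)
  map_tensor : ∀ {m n m' n' : ℕ} (f : P.Hom m n) (g : P.Hom m' n'),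
    map (P.tensor f g) = Q.tensor (map f) (map g)
  map_symm : ∀ m n : ℕ, map (P.symm m n) = Q.symm m n

/-- An isomorphism of props: a homomorphism with a two-sided inverse homomorphism. -/
structure PROPIso (P : PROP.{u}) (Q : PROP.{v}) where
  hom : PROPHom P Q
  inv : PROPHom Q P
  hom_inv : ∀ {m n : ℕ} (f : P.Hom m n), inv.map (hom.map f) = f
  inv_hom : ∀ {m n : ℕ} (g : Q.Hom m n), hom.map (inv.map g) = g

section relational

variable {S : Type v}

theorem append_parts {m n : ℕ} (x : Fin (m + n) → S) :
    Fin.append (x ∘ Fin.castAdd n) (x ∘ Fin.natAdd m) = x := by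
  funext i
  refine Fin.addCases (fun i => ?_) (fun i => ?_) i <;> simp

theorem parts_ext {m n : ℕ} {x y : Fin (m + n) → S}
    (h₁ : x ∘ Fin.castAdd n = y ∘ Fin.castAdd n) (h₂ : x ∘ Fin.natAdd m = y ∘ Fin.natAdd m) :
    x = y := by
  rw [← append_parts x, h₁, h₂, append_parts]

theorem append_castAdd {m n : ℕ} (x : Fin m → S) (y : Fin n → S) :
    Fin.append x y ∘ Fin.castAdd n = x := by
  funext i; simp

theorem append_natAdd {m n : ℕ} (x : Fin m → S) (y : Fin n → S) :
    Fin.append x y ∘ Fin.natAdd m = y := by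
  funext i; simp

theorem exists_append {m n : ℕ} {p : (Fin (m + n) → S) → Prop} :
    (∃ x, p x) ↔ ∃ (x₁ : Fin m → S) (x₂ : Fin n → S), p (Fin.append x₁ x₂) :=
  ⟨fun ⟨x, hx⟩ => ⟨x ∘ Fin.castAdd n, x ∘ Fin.natAdd m, by rwa [append_parts]⟩,
    fun ⟨_, _, h⟩ => ⟨_, h⟩⟩

/-- Operations that are faithfully interpreted as relations between finite families, with
relational composition and direct product, satisfy the laws of a prop. -/
theorem PROPData.isPROP_of_rel (P : PROPData.{u})
    (ρ : ∀ {m n : ℕ}, P.Hom m n → (Fin m → S) → (Fin n → S) → Prop)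
    (inj : ∀ {m n : ℕ} (f g : P.Hom m n), (∀ x y, ρ f x y ↔ ρ g x y) → f = g)
    (hid : ∀ n x y, ρ (P.id n) x y ↔ x = y)
    (hcomp : ∀ {l m n : ℕ} (f : P.Hom l m) (g : P.Hom m n) (x z),
      ρ (P.comp f g) x z ↔ ∃ y, ρ f x y ∧ ρ g y z)
    (htensor : ∀ {m n m' n' : ℕ} (f : P.Hom m n) (g : P.Hom m' n') (x y),
      ρ (P.tensor f g) x y ↔
        ρ f (x ∘ Fin.castAdd m') (y ∘ Fin.castAdd n') ∧
          ρ g (x ∘ Fin.natAdd m) (y ∘ Fin.natAdd n))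
    (hsymm : ∀ m n x y, ρ (P.symm m n) x y ↔
      y ∘ Fin.castAdd m = x ∘ Fin.natAdd m ∧ y ∘ Fin.natAdd n = x ∘ Fin.castAdd n) :
    P.IsPROP := by
  have hcast : ∀ {m n m' n' : ℕ} (hm : m = m') (hn : n = n') (f : P.Hom m n) x y,
      ρ (P.cast hm hn f) x y ↔ ρ f (x ∘ Fin.cast hm) (y ∘ Fin.cast hn) := by
    intro m n m' n' hm hn f x y
    subst hm hn
    rfl
  constructor
  · intro m n f
    refine inj _ _ fun x y => ?_
    simp [hcomp, hid]
  · intro m n f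
    refine inj _ _ fun x y => ?_
    simp [hcomp, hid]
  · intro k l m n f g h
    refine inj _ _ fun x y => ?_
    simp only [hcomp]
    grind
  · intro m n
    refine inj _ _ fun x y => ?_
    simp only [htensor, hid]
    exact ⟨fun h => parts_ext h.1 h.2, fun h => by simp [h]⟩
  · intro l m n l' m' n' f g f' g'
    refine inj _ _ fun x y => ?_
    simp only [htensor, hcomp, exists_append, append_castAdd, append_natAdd]
    grind
  · intro m n m' n' m'' n'' f g h
    refine inj _ _ fun x y => ?_
    simp only [htensor, hcast, and_assoc]
    have e₁ : ∀ {a b c : ℕ} (z : Fin (a + (b + c)) → S),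
        ((z ∘ Fin.cast (Nat.add_assoc a b c)) ∘ Fin.castAdd c) ∘ Fin.castAdd b =
          z ∘ Fin.castAdd (b + c) := by
      intros; rfl
    have e₂ : ∀ {a b c : ℕ} (z : Fin (a + (b + c)) → S),
        ((z ∘ Fin.cast (Nat.add_assoc a b c)) ∘ Fin.castAdd c) ∘ Fin.natAdd a =
          (z ∘ Fin.natAdd a) ∘ Fin.castAdd c := by
      intros; rfl
    have e₃ : ∀ {a b c : ℕ} (z : Fin (a + (b + c)) → S),
        (z ∘ Fin.cast (Nat.add_assoc a b c)) ∘ Fin.natAdd (a + b) =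
          (z ∘ Fin.natAdd a) ∘ Fin.natAdd b := by
      intro a b c z
      funext i
      simp only [Function.comp]
      congr 1
      ext
      simp [Nat.add_assoc]
    rw [e₁, e₁, e₂, e₂, e₃, e₃]
  · intro m n f
    refine inj _ _ fun x y => ?_
    have e : ∀ {a : ℕ} (z : Fin a → S),
        (z ∘ Fin.cast (Nat.zero_add a)) ∘ Fin.natAdd 0 = z := by
      intro a z
      funext i
      simp only [Function.comp]
      congr 1
      ext
      simp
    simp only [hcast, htensor, hid, e]
    exact and_iff_right (funext fun i => i.elim0)
  · intro m n f
    refine inj _ _ fun x y => ?_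
    simp only [hcast, htensor, hid]
    exact and_iff_left (funext fun i => i.elim0)
  · intro m n m' n' f g
    refine inj _ _ fun x y => ?_
    simp only [htensor, hcomp, hsymm, exists_append, append_castAdd, append_natAdd]
    grind
  · intro m n
    refine inj _ _ fun x y => ?_
    simp only [hcomp, hsymm, hid, exists_append, append_castAdd, append_natAdd]
    constructor
    · rintro ⟨a, b, ⟨rfl, rfl⟩, h₁, h₂⟩
      exact (parts_ext h₁ h₂).symm
    · rintro rfl
      exact ⟨_, _, ⟨rfl, rfl⟩, rfl, rfl⟩
  · intro m n p
    refine inj _ _ fun x y => ?_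
    simp only [hcomp, htensor, hcast, hsymm, hid]
    constructor
    · rintro ⟨z, ⟨⟨h₁, h₂⟩, h₃⟩, h₄, h₅, h₆⟩
      simp only [funext_iff, Function.comp] at *
      refine ⟨fun i => ?_, fun i => ?_⟩
      · refine Fin.addCases (fun i => ?_) (fun i => ?_) i
        · exact (h₄ i).symm.trans (h₁ i)
        · refine (h₅ i).trans (Eq.trans ?_ ((h₃ i).symm.trans ?_)) <;> congr 1 <;> ext <;>
            simp [Nat.add_assoc]
      · refine Eq.trans ?_ ((h₆ i).trans ((h₂ i).trans ?_)) <;> congr 1 ; ext ; 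
            simp [Nat.add_assoc]
    · rintro ⟨h₁, h₂⟩
      simp only [funext_iff, Function.comp] at *
      refine ⟨Fin.append (fun i => x (Fin.castAdd p (Fin.natAdd m i)))
        (Fin.append (fun i => x (Fin.castAdd p (Fin.castAdd n i)))
          (fun i => x (Fin.natAdd _ i))),
        ⟨⟨fun i => Fin.append_left _ _ _, fun i => ?_⟩, fun i => ?_⟩,
        fun i => ?_, fun i => ?_, fun i => ?_⟩
      · have e : Fin.cast (Nat.add_assoc n m p) (Fin.castAdd p (Fin.natAdd n i)) =
            Fin.natAdd n (Fin.castAdd p i) := by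
          ext; simp
        rw [e, Fin.append_right, Fin.append_left]
        rfl
      · have e : Fin.cast (Nat.add_assoc n m p) (Fin.natAdd (n + m) i) =
            Fin.natAdd n (Fin.natAdd m i) := by
          ext; simp [Nat.add_assoc]
        rw [e, Fin.append_right, Fin.append_right]
        rfl
      · rw [Fin.append_left]
        exact (h₁ (Fin.castAdd p i)).symm
      · rw [Fin.append_right, Fin.append_right]
        refine Eq.trans ?_ ((h₁ (Fin.natAdd n i)).trans ?_) <;> congr 1
        ext; simp [Nat.add_assoc]
      · rw [Fin.append_right, Fin.append_left]
        refine Eq.trans ?_ (h₂ i) ; congr 1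
        ext; simp [Nat.add_assoc]

end relational

/-! ### The prop of matrices -/

section matrices

/-- The copairing `[A B]` of two matrices with the same number of rows. -/
def copair {X : Type u} {m n d : ℕ} (A : Matrix (Fin d) (Fin m) X)
    (B : Matrix (Fin d) (Fin n) X) : Matrix (Fin d) (Fin (m + n)) X :=
  (Matrix.fromCols A B).submatrix id finSumFinEquiv.symm

theorem copair_inj {X : Type u} {m n d : ℕ} {A A' : Matrix (Fin d) (Fin m) X}
    {B B' : Matrix (Fin d) (Fin n) X} (h : copair A B = copair A' B') : A = A' ∧ B = B' := by
  constructor <;> ext i j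
  · simpa [copair] using congrFun (congrFun h i) (Fin.castAdd n j)
  · simpa [copair] using congrFun (congrFun h i) (Fin.natAdd m j)

variable {R : Type u} [CommRing R]

/-- The monoidal product of matrices: the block diagonal matrix with blocks `A` and `B`. -/
def blockDiag {m n m' n' : ℕ} (A : Matrix (Fin n) (Fin m) R) (B : Matrix (Fin n') (Fin m') R) :
    Matrix (Fin (n + n')) (Fin (m + m')) R :=
  (Matrix.fromBlocks A 0 0 B).submatrix finSumFinEquiv.symm finSumFinEquiv.symm

variable (R) in
/-- The permutation matrix sending `(x, y)` to `(y, x)`, for `x` of length `m` and `y` of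
length `n`. -/
def swapMatrix (m n : ℕ) : Matrix (Fin (n + m)) (Fin (m + n)) R :=
  Matrix.of fun i j => if i = finAddFlip j then 1 else 0

theorem blockDiag_mulVec {m n m' n' : ℕ} (A : Matrix (Fin n) (Fin m) R)
    (B : Matrix (Fin n') (Fin m') R) (x : Fin (m + m') → R) :
    blockDiag A B *ᵥ x =
      Fin.append (A *ᵥ (x ∘ Fin.castAdd m')) (B *ᵥ (x ∘ Fin.natAdd m)) := by
  refine parts_ext ?_ ?_ <;> funext i <;>
    simp [blockDiag, Matrix.mulVec, dotProduct, Fin.sum_univ_add]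

theorem vecMul_blockDiag {m n m' n' : ℕ} (A : Matrix (Fin n) (Fin m) R)
    (B : Matrix (Fin n') (Fin m') R) (x : Fin (n + n') → R) :
    x ᵥ* blockDiag A B =
      Fin.append ((x ∘ Fin.castAdd n') ᵥ* A) ((x ∘ Fin.natAdd n) ᵥ* B) := by
  refine parts_ext ?_ ?_ <;> funext i <;>
    simp [blockDiag, Matrix.vecMul, dotProduct, Fin.sum_univ_add]

theorem vecMul_swapMatrix {m n : ℕ} (x : Fin (n + m) → R) :
    x ᵥ* swapMatrix R m n = x ∘ finAddFlip := by
  funext i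
  simp [swapMatrix, Matrix.vecMul, dotProduct]

theorem swapMatrix_mulVec {m n : ℕ} (x : Fin (m + n) → R) :
    swapMatrix R m n *ᵥ x = x ∘ finAddFlip := by
  have h : (finAddFlip : Fin (m + n) ≃ Fin (n + m)).symm = finAddFlip := by
    refine Equiv.ext fun i => ?_
    rw [Equiv.symm_apply_eq]
    refine Fin.addCases (fun i => ?_) (fun i => ?_) i <;> simp
  funext i
  simp [swapMatrix, Matrix.mulVec, dotProduct, ← Equiv.symm_apply_eq, h]

theorem vecMul_copair {m n d : ℕ} (A : Matrix (Fin d) (Fin m) R) (B : Matrix (Fin d) (Fin n) R)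
    (x : Fin d → R) : x ᵥ* copair A B = Fin.append (x ᵥ* A) (x ᵥ* B) := by
  refine parts_ext ?_ ?_ <;> funext i <;> simp [copair, Matrix.vecMul, dotProduct]

theorem mul_copair {m n d e : ℕ} (X : Matrix (Fin e) (Fin d) R) (A : Matrix (Fin d) (Fin m) R)
    (B : Matrix (Fin d) (Fin n) R) : X * copair A B = copair (X * A) (X * B) := by
  ext i j
  refine Fin.addCases (fun j => ?_) (fun j => ?_) j <;> simp [copair, Matrix.mul_apply]

variable (R) in
/-- The operations of the prop of matrices over `R`: an arrow `m → n` is an `n × m` matrix,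
composition is matrix multiplication, the monoidal product is the block diagonal matrix, and the
symmetries are permutation matrices. -/
def matData : PROPData.{u} where
  Hom m n := Matrix (Fin n) (Fin m) R
  id n := (1 : Matrix (Fin n) (Fin n) R)
  comp A B := B * A
  tensor A B := blockDiag A B
  symm m n := swapMatrix R m n

theorem matData_isPROP : (matData R).IsPROP := by
  refine PROPData.isPROP_of_rel (S := R) (matData R)
    (fun {m n} (A : Matrix (Fin n) (Fin m) R) x y => y = A *ᵥ x) ?_ ?_ ?_ ?_ ?_
  · intro m n A B h
    refine Matrix.mulVec_injective (funext fun x => ?_)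
    exact (h x _).1 rfl
  · intro n x y
    change y = (1 : Matrix _ _ R) *ᵥ x ↔ _
    rw [Matrix.one_mulVec, eq_comm]
  · intro l m n (A : Matrix (Fin m) (Fin l) R) (B : Matrix (Fin n) (Fin m) R) x z
    change z = (B * A : Matrix _ _ R) *ᵥ x ↔ _
    simp [Matrix.mulVec_mulVec]
  · intro m n m' n' (A : Matrix (Fin n) (Fin m) R) (B : Matrix (Fin n') (Fin m') R) x y
    change y = blockDiag A B *ᵥ x ↔ _
    rw [blockDiag_mulVec]
    constructor
    · rintro rfl
      exact ⟨append_castAdd _ _, append_natAdd _ _⟩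
    · rintro ⟨h₁, h₂⟩
      rw [← h₁, ← h₂, append_parts]
  · intro m n x y
    change y = swapMatrix R m n *ᵥ x ↔ _
    rw [swapMatrix_mulVec]
    constructor
    · rintro rfl
      constructor <;> funext i <;> simp
    · rintro ⟨h₁, h₂⟩
      refine parts_ext (h₁.trans ?_) (h₂.trans ?_) <;> funext i <;> simp

variable (R) in
/-- The prop of matrices over `R`. -/
def Mat : PROP.{u} where
  toPROPData := matData R
  isPROP := matData_isPROP

/-- A matrix `A : m → n` is an epimorphism in the prop of matrices: two arrows `n → p` that agree
after precomposition with `A` are equal. -/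
def IsEpi {m n : ℕ} (A : Matrix (Fin n) (Fin m) R) : Prop :=
  ∀ (p : ℕ) (X Y : Matrix (Fin p) (Fin n) R), X * A = Y * A → X = Y

/-- A matrix is a split monomorphism in the prop of matrices. -/
def IsSplitMono {m n : ℕ} (A : Matrix (Fin n) (Fin m) R) : Prop :=
  ∃ A' : Matrix (Fin m) (Fin n) R, A' * A = 1

/-- `d --C--> p <--D-- e` is a pushout in the prop of matrices of `d <--B-- n --A--> e`. -/
def IsMatPushout {n d e p : ℕ} (B : Matrix (Fin d) (Fin n) R) (A : Matrix (Fin e) (Fin n) R)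
    (C : Matrix (Fin p) (Fin d) R) (D : Matrix (Fin p) (Fin e) R) : Prop :=
  C * B = D * A ∧
    ∀ (q : ℕ) (X : Matrix (Fin q) (Fin d) R) (Y : Matrix (Fin q) (Fin e) R), X * B = Y * A →
      ∃! Z : Matrix (Fin q) (Fin p) R, Z * C = X ∧ Z * D = Y

/-! ### Cospans and corelations of matrices -/

variable (R) in
/-- A cospan `m --A--> d <--B-- n` of matrices. -/
structure Cospan (m n : ℕ) where
  apex : ℕ
  left : Matrix (Fin apex) (Fin m) R
  right : Matrix (Fin apex) (Fin n) R

/-- A cospan is jointly epic if its copairing is an epimorphism. -/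
def Cospan.JointlyEpic {m n : ℕ} (f : Cospan R m n) : Prop :=
  IsEpi (copair f.left f.right)

/-- Isomorphism of cospans: an invertible matrix between the apices that commutes with the legs. -/
def Cospan.Iso {m n : ℕ} (f g : Cospan R m n) : Prop :=
  ∃ (U : Matrix (Fin g.apex) (Fin f.apex) R) (V : Matrix (Fin f.apex) (Fin g.apex) R),
    U * V = 1 ∧ V * U = 1 ∧ U * f.left = g.left ∧ U * f.right = g.right

/-- The row relation of a cospan, in which isomorphism and composition become transparent. -/
def Cospan.rowRel {m n : ℕ} (f : Cospan R m n) (x : Fin m → R) (y : Fin n → R) : Prop :=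
  ∃ c, c ᵥ* f.left = x ∧ c ᵥ* f.right = y

theorem isEpi_iff {m n : ℕ} (A : Matrix (Fin n) (Fin m) R) :
    IsEpi A ↔ ∀ c, c ᵥ* A = 0 → c = 0 := by
  constructor
  · intro h c hc
    have := h 1 (Matrix.of fun _ => c) 0 (by
      ext i j
      simpa [Matrix.mul_apply, Matrix.vecMul, dotProduct] using congrFun hc j)
    funext j
    simpa using congrFun (congrFun this 0) j
  · intro h p X Y hXY
    rw [← sub_eq_zero]
    ext i j
    refine congrFun (h ((X - Y) i) ?_) j
    have : (X - Y) * A = 0 := by rw [Matrix.sub_mul, hXY, sub_self]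
    rw [← Matrix.mul_apply_eq_vecMul, this]
    rfl

theorem Cospan.jointlyEpic_iff {m n : ℕ} (f : Cospan R m n) :
    f.JointlyEpic ↔ ∀ c, c ᵥ* f.left = 0 → c ᵥ* f.right = 0 → c = 0 := by
  have h0 : (0 : Fin (m + n) → R) = Fin.append 0 0 := by
    refine parts_ext ?_ ?_ <;> funext i <;> simp
  rw [JointlyEpic, isEpi_iff]
  refine forall_congr' fun c => ?_
  rw [vecMul_copair]
  constructor
  · intro h h₁ h₂
    exact h (by rw [h₁, h₂, h0])
  · intro h h₁
    rw [h0] at h₁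
    refine h ?_ ?_
    · simpa only [append_castAdd] using congrArg (· ∘ Fin.castAdd n) h₁
    · simpa only [append_natAdd] using congrArg (· ∘ Fin.natAdd m) h₁

theorem exists_matrix_of_rows {m n d e : ℕ} (A : Matrix (Fin d) (Fin m) R)
    (B : Matrix (Fin d) (Fin n) R) (A' : Matrix (Fin e) (Fin m) R) (B' : Matrix (Fin e) (Fin n) R)
    (h : ∀ i, ∃ c, c ᵥ* A = A' i ∧ c ᵥ* B = B' i) :
    ∃ U : Matrix (Fin e) (Fin d) R, U * A = A' ∧ U * B = B' := by
  choose U hU using h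
  refine ⟨Matrix.of U, ?_, ?_⟩ <;> funext i
  · exact (hU i).1
  · exact (hU i).2

theorem JointlyEpic.cancel {m n d e : ℕ} {A : Matrix (Fin d) (Fin m) R}
    {B : Matrix (Fin d) (Fin n) R} (h : IsEpi (copair A B)) {X Y : Matrix (Fin e) (Fin d) R}
    (h₁ : X * A = Y * A) (h₂ : X * B = Y * B) : X = Y := by
  refine h e X Y ?_
  rw [mul_copair, mul_copair, h₁, h₂]

theorem Cospan.row_rowRel {m n : ℕ} (f : Cospan R m n) (i : Fin f.apex) :
    f.rowRel (f.left i) (f.right i) :=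
  ⟨Pi.single i 1, by simp [Matrix.row], by simp [Matrix.row]⟩

theorem Cospan.Iso.rowRel_iff {m n : ℕ} {f g : Cospan R m n} (h : f.Iso g) (x : Fin m → R)
    (y : Fin n → R) : f.rowRel x y ↔ g.rowRel x y := by
  obtain ⟨U, V, hUV, hVU, h₁, h₂⟩ := h
  constructor
  · rintro ⟨c, rfl, rfl⟩
    refine ⟨c ᵥ* V, ?_, ?_⟩
    · rw [← h₁, Matrix.vecMul_vecMul, ← Matrix.mul_assoc, hVU, Matrix.one_mul]
    · rw [← h₂, Matrix.vecMul_vecMul, ← Matrix.mul_assoc, hVU, Matrix.one_mul]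
  · rintro ⟨c, rfl, rfl⟩
    exact ⟨c ᵥ* U, by rw [Matrix.vecMul_vecMul, h₁], by rw [Matrix.vecMul_vecMul, h₂]⟩

theorem Cospan.iso_of_rowRel {m n : ℕ} {f g : Cospan R m n} (hf : f.JointlyEpic)
    (hg : g.JointlyEpic) (h : ∀ x y, f.rowRel x y ↔ g.rowRel x y) : f.Iso g := by
  obtain ⟨U, hU₁, hU₂⟩ := exists_matrix_of_rows f.left f.right g.left g.right
    fun i => (h _ _).2 (g.row_rowRel i)
  obtain ⟨V, hV₁, hV₂⟩ := exists_matrix_of_rows g.left g.right f.left f.right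
    fun i => (h _ _).1 (f.row_rowRel i)
  refine ⟨U, V, JointlyEpic.cancel hg ?_ ?_, JointlyEpic.cancel hf ?_ ?_, hU₁, hU₂⟩ <;>
    rw [Matrix.mul_assoc, Matrix.one_mul]
  · rw [hV₁, hU₁]
  · rw [hV₂, hU₂]
  · rw [hU₁, hV₁]
  · rw [hU₂, hV₂]

variable (R) in
/-- Jointly epic cospans up to isomorphism of cospans. -/
def corelSetoid (m n : ℕ) : Setoid {f : Cospan R m n // f.JointlyEpic} where
  r f g := f.1.Iso g.1
  iseqv :=
    { refl := fun f => Cospan.iso_of_rowRel f.2 f.2 fun _ _ => Iff.rfl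
      symm := fun {f g} h => Cospan.iso_of_rowRel g.2 f.2 fun x y => (h.rowRel_iff x y).symm
      trans := fun {f _ g} h h' => Cospan.iso_of_rowRel f.2 g.2 fun x y =>
        (h.rowRel_iff x y).trans (h'.rowRel_iff x y) }

variable (R) in
/-- A corelation `m → n` of matrices: an isomorphism class of jointly epic cospans. -/
def Corel (m n : ℕ) : Type u :=
  Quotient (corelSetoid R m n)

/-- The corelation of a jointly epic cospan `m --A--> d <--B-- n`. -/
def Corel.mk {m n d : ℕ} (A : Matrix (Fin d) (Fin m) R) (B : Matrix (Fin d) (Fin n) R)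
    (h : IsEpi (copair A B)) : Corel R m n :=
  Quotient.mk (corelSetoid R m n) ⟨⟨d, A, B⟩, h⟩

/-- `h` is a composite of the corelations `f` and `g`: form the pushout of the inner legs of `f`
and `g`, and factorise the copairing of the resulting cospan as the copairing of `h`, which is an
epimorphism, followed by a split monomorphism. -/
def IsCorelComp {l m n : ℕ} (f : Cospan R l m) (g : Cospan R m n) (h : Cospan R l n) : Prop :=
  h.JointlyEpic ∧
    ∃ (p : ℕ) (C : Matrix (Fin p) (Fin f.apex) R) (D : Matrix (Fin p) (Fin g.apex) R),
      IsMatPushout f.right g.left C D ∧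
        ∃ M : Matrix (Fin p) (Fin h.apex) R, IsSplitMono M ∧
          M * copair h.left h.right = copair (C * f.left) (D * g.right)

theorem IsCorelComp.rowRel_iff {l m n : ℕ} {f : Cospan R l m} {g : Cospan R m n}
    {h : Cospan R l n} (H : IsCorelComp f g h) (x : Fin l → R) (z : Fin n → R) :
    h.rowRel x z ↔ ∃ y, f.rowRel x y ∧ g.rowRel y z := by
  obtain ⟨-, p, C, D, ⟨hCD, hu⟩, M, ⟨M', hM'⟩, hM⟩ := H
  rw [mul_copair] at hM
  obtain ⟨hl, hr⟩ := copair_inj hM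
  constructor
  · rintro ⟨c, rfl, rfl⟩
    have e₁ : h.left = M' * C * f.left := by
      rw [Matrix.mul_assoc, ← hl, ← Matrix.mul_assoc, hM', Matrix.one_mul]
    have e₂ : h.right = M' * D * g.right := by
      rw [Matrix.mul_assoc, ← hr, ← Matrix.mul_assoc, hM', Matrix.one_mul]
    refine ⟨c ᵥ* (M' * C * f.right), ⟨c ᵥ* (M' * C), ?_, ?_⟩, c ᵥ* (M' * D), ?_, ?_⟩
    · rw [Matrix.vecMul_vecMul, e₁]
    · rw [Matrix.vecMul_vecMul]
    · rw [Matrix.vecMul_vecMul, Matrix.mul_assoc, Matrix.mul_assoc, hCD]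
    · rw [Matrix.vecMul_vecMul, e₂]
  · rintro ⟨y, ⟨c, rfl, rfl⟩, c', h₁, rfl⟩
    obtain ⟨Z, ⟨hZ₁, hZ₂⟩, -⟩ := hu 1 (Matrix.of fun _ => c) (Matrix.of fun _ => c') (by
      ext i j
      exact (congrFun h₁ j).symm)
    have hc : Z 0 ᵥ* C = c := congrFun hZ₁ 0
    have hc' : Z 0 ᵥ* D = c' := congrFun hZ₂ 0
    refine ⟨Z 0 ᵥ* M, ?_, ?_⟩
    · rw [Matrix.vecMul_vecMul, hl, ← Matrix.vecMul_vecMul, hc]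
    · rw [Matrix.vecMul_vecMul, hr, ← Matrix.vecMul_vecMul, hc']

section pid

variable [IsDomain R] [IsPrincipalIdealRing R]

/-- Over a principal ideal domain, a submodule of `Rᵐ × Rⁿ` has a basis, formed by the rows of a
jointly epic cospan. -/
theorem exists_cospan_of_submodule {m n : ℕ} (N : Submodule R ((Fin m → R) × (Fin n → R))) :
    ∃ f : Cospan R m n, f.JointlyEpic ∧ ∀ x y, f.rowRel x y ↔ (x, y) ∈ N := by
  obtain ⟨d, ⟨b⟩⟩ := N.nonempty_basis_of_pid ((Pi.basisFun R (Fin m)).prod (Pi.basisFun R (Fin n)))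
  let f : Cospan R m n :=
    ⟨d, Matrix.of fun i => (b i : (Fin m → R) × (Fin n → R)).1,
      Matrix.of fun i => (b i : (Fin m → R) × (Fin n → R)).2⟩
  have key : ∀ c : Fin d → R, (c ᵥ* f.left, c ᵥ* f.right) =
      ((∑ i, c i • b i : N) : (Fin m → R) × (Fin n → R)) := by
    intro c
    refine Prod.ext ?_ ?_ <;> funext j <;>
      simp [f, Matrix.vecMul, dotProduct, Prod.fst_sum, Prod.snd_sum]
  refine ⟨f, f.jointlyEpic_iff.2 fun c h₁ h₂ => ?_, fun x y => ⟨?_, fun h => ?_⟩⟩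
  · have h := key c
    rw [h₁, h₂] at h
    have h0 : (∑ i, c i • b i : N) = 0 := Subtype.ext h.symm
    funext i
    exact Fintype.linearIndependent_iff.1 b.linearIndependent c h0 i
  · rintro ⟨c, rfl, rfl⟩
    rw [key c]
    exact Subtype.property _
  · have h' := key (fun i => b.repr ⟨(x, y), h⟩ i)
    rw [b.sum_repr] at h'
    exact ⟨_, congrArg Prod.fst h', congrArg Prod.snd h'⟩

theorem exists_isMatPushout {n d e : ℕ} (B : Matrix (Fin d) (Fin n) R)
    (A : Matrix (Fin e) (Fin n) R) :
    ∃ (p : ℕ) (C : Matrix (Fin p) (Fin d) R) (D : Matrix (Fin p) (Fin e) R),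
      IsMatPushout B A C D := by
  obtain ⟨f, hf, h⟩ := exists_cospan_of_submodule
    (LinearMap.ker ((Matrix.vecMulLinear B).comp (LinearMap.fst R _ _) -
      (Matrix.vecMulLinear A).comp (LinearMap.snd R _ _)))
  have h' : ∀ x y, f.rowRel x y ↔ x ᵥ* B = y ᵥ* A := by
    intro x y
    rw [h]
    simp [sub_eq_zero]
  refine ⟨f.apex, f.left, f.right, ?_, fun q X Y hXY => ?_⟩
  · funext i
    exact (h' _ _).1 (f.row_rowRel i)
  · obtain ⟨Z, hZ⟩ := exists_matrix_of_rows f.left f.right X Y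
      fun i => (h' _ _).2 (congrFun hXY i)
    exact ⟨Z, hZ, fun Z' hZ' => JointlyEpic.cancel hf (hZ'.1.trans hZ.1.symm)
      (hZ'.2.trans hZ.2.symm)⟩

/-- The factorisation of the copairing of a cospan as an epimorphism followed by a split
monomorphism. -/
theorem exists_factorisation {m n d : ℕ} (A : Matrix (Fin d) (Fin m) R)
    (B : Matrix (Fin d) (Fin n) R) :
    ∃ f : Cospan R m n, f.JointlyEpic ∧ ∃ M : Matrix (Fin d) (Fin f.apex) R, IsSplitMono M ∧
      M * copair f.left f.right = copair A B := by
  obtain ⟨f, hf, h⟩ := exists_cospan_of_submodule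
    (LinearMap.range ((Matrix.vecMulLinear A).prod (Matrix.vecMulLinear B)))
  have h' : ∀ x y, f.rowRel x y ↔ ∃ c, c ᵥ* A = x ∧ c ᵥ* B = y := by
    intro x y
    rw [h]
    simp
  obtain ⟨M, hM₁, hM₂⟩ := exists_matrix_of_rows f.left f.right A B
    fun i => (h' _ _).2 (Cospan.row_rowRel ⟨d, A, B⟩ i)
  obtain ⟨M', hM'₁, hM'₂⟩ := exists_matrix_of_rows A B f.left f.right
    fun i => (h' _ _).1 (f.row_rowRel i)
  refine ⟨f, hf, M, ⟨M', JointlyEpic.cancel hf ?_ ?_⟩, ?_⟩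
  · rw [Matrix.mul_assoc, hM₁, hM'₁, Matrix.one_mul]
  · rw [Matrix.mul_assoc, hM₂, hM'₂, Matrix.one_mul]
  · rw [mul_copair, hM₁, hM₂]

theorem exists_isCorelComp {l m n : ℕ} (f : Cospan R l m) (g : Cospan R m n) :
    ∃ h : {h : Cospan R l n // h.JointlyEpic}, IsCorelComp f g h.1 := by
  obtain ⟨p, C, D, hp⟩ := exists_isMatPushout f.right g.left
  obtain ⟨h, hh, M, hM⟩ := exists_factorisation (C * f.left) (D * g.right)
  exact ⟨⟨h, hh⟩, hh, p, C, D, hp, M, hM⟩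

/-- Composition of corelations: the composite of representatives in the sense of `IsCorelComp`,
which exists and is unique up to isomorphism; see `Corel.comp_mk_eq`. -/
noncomputable def Corel.comp {l m n : ℕ} : Corel R l m → Corel R m n → Corel R l n :=
  Quotient.lift₂
    (fun f g => Quotient.mk (corelSetoid R l n) (Classical.choose (exists_isCorelComp f.1 g.1)))
    (by
      intro f g f' g' hf hg
      refine Quotient.sound (Cospan.iso_of_rowRel (Subtype.property _) (Subtype.property _) ?_)
      intro x z
      rw [(Classical.choose_spec (exists_isCorelComp f.1 g.1)).rowRel_iff,
        (Classical.choose_spec (exists_isCorelComp f'.1 g'.1)).rowRel_iff]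
      refine exists_congr fun y => ?_
      rw [Cospan.Iso.rowRel_iff hf, Cospan.Iso.rowRel_iff hg])

/-- Any pushout and any factorisation compute the composite of two corelations. -/
theorem Corel.comp_mk_eq {l m n : ℕ} (f : {f : Cospan R l m // f.JointlyEpic})
    (g : {g : Cospan R m n // g.JointlyEpic}) (h : {h : Cospan R l n // h.JointlyEpic})
    (H : IsCorelComp f.1 g.1 h.1) :
    Corel.comp (Quotient.mk (corelSetoid R l m) f) (Quotient.mk (corelSetoid R m n) g) =
      Quotient.mk (corelSetoid R l n) h := by
  refine Quotient.sound (Cospan.iso_of_rowRel (Subtype.property _) h.2 fun x z => ?_)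
  rw [(Classical.choose_spec (exists_isCorelComp f.1 g.1)).rowRel_iff, H.rowRel_iff]

end pid

theorem jointlyEpic_of_right_one {m n : ℕ} (A : Matrix (Fin n) (Fin m) R) :
    IsEpi (copair A (1 : Matrix (Fin n) (Fin n) R)) :=
  (Cospan.jointlyEpic_iff ⟨n, A, 1⟩).2 fun c _ h => by simpa using h

/-- The direct sum of two cospans. -/
def Cospan.tensor {m n m' n' : ℕ} (f : Cospan R m n) (g : Cospan R m' n') :
    Cospan R (m + m') (n + n') where
  apex := f.apex + g.apex
  left := blockDiag f.left g.left
  right := blockDiag f.right g.right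

theorem Cospan.tensor_rowRel {m n m' n' : ℕ} (f : Cospan R m n) (g : Cospan R m' n')
    (x : Fin (m + m') → R) (y : Fin (n + n') → R) :
    (f.tensor g).rowRel x y ↔ f.rowRel (x ∘ Fin.castAdd m') (y ∘ Fin.castAdd n') ∧
      g.rowRel (x ∘ Fin.natAdd m) (y ∘ Fin.natAdd n) := by
  have h : (f.tensor g).rowRel x y ↔ ∃ c : Fin (f.apex + g.apex) → R,
      c ᵥ* blockDiag f.left g.left = x ∧ c ᵥ* blockDiag f.right g.right = y := Iff.rfl
  rw [h, exists_append]
  simp only [vecMul_blockDiag, append_castAdd, append_natAdd]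
  constructor
  · rintro ⟨c, c', rfl, rfl⟩
    simp only [append_castAdd, append_natAdd]
    exact ⟨⟨c, rfl, rfl⟩, c', rfl, rfl⟩
  · rintro ⟨⟨c, h₁, h₂⟩, c', h₃, h₄⟩
    exact ⟨c, c', by rw [h₁, h₃, append_parts], by rw [h₂, h₄, append_parts]⟩

theorem Cospan.JointlyEpic.tensor {m n m' n' : ℕ} {f : Cospan R m n} {g : Cospan R m' n'}
    (hf : f.JointlyEpic) (hg : g.JointlyEpic) : (f.tensor g).JointlyEpic := by
  rw [Cospan.jointlyEpic_iff] at *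
  intro c h₁ h₂
  have h₁' := (vecMul_blockDiag f.left g.left c).symm.trans h₁
  have h₂' := (vecMul_blockDiag f.right g.right c).symm.trans h₂
  refine parts_ext (hf _ ?_ ?_) (hg _ ?_ ?_)
  · exact (append_castAdd _ _).symm.trans (congrArg (· ∘ Fin.castAdd m') h₁')
  · exact (append_castAdd _ _).symm.trans (congrArg (· ∘ Fin.castAdd n') h₂')
  · exact (append_natAdd _ _).symm.trans (congrArg (· ∘ Fin.natAdd m) h₁')
  · exact (append_natAdd _ _).symm.trans (congrArg (· ∘ Fin.natAdd n) h₂')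

/-- The monoidal product of corelations, induced by the direct sum of cospans. -/
def Corel.tensor {m n m' n' : ℕ} : Corel R m n → Corel R m' n' → Corel R (m + m') (n + n') :=
  Quotient.lift₂
    (fun f g => Quotient.mk (corelSetoid R _ _) ⟨f.1.tensor g.1, f.2.tensor g.2⟩)
    (by
      intro f g f' g' hf hg
      refine Quotient.sound (Cospan.iso_of_rowRel (Subtype.property _) (Subtype.property _) ?_)
      intro x y
      rw [Cospan.tensor_rowRel, Cospan.tensor_rowRel, Cospan.Iso.rowRel_iff hf,
        Cospan.Iso.rowRel_iff hg])

variable (R) in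
/-- The operations of the prop of corelations of matrices over a principal ideal domain. The
identities and symmetries are those of matrices, a matrix `A : m → n` being viewed as the
corelation `m --A--> n <--1-- n`. -/
noncomputable def corelData [IsDomain R] [IsPrincipalIdealRing R] : PROPData.{u} where
  Hom m n := Corel R m n
  id n := Corel.mk (1 : Matrix (Fin n) (Fin n) R) 1 (jointlyEpic_of_right_one _)
  comp f g := Corel.comp f g
  tensor f g := Corel.tensor f g
  symm m n := Corel.mk (swapMatrix R m n) 1 (jointlyEpic_of_right_one _)

/-- The row relation of a corelation. -/
def Corel.rowRel {m n : ℕ} (f : Corel R m n) (x : Fin m → R) (y : Fin n → R) : Prop :=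
  Quotient.lift (fun f : {f : Cospan R m n // f.JointlyEpic} => f.1.rowRel x y)
    (fun _ _ h => propext (Cospan.Iso.rowRel_iff h x y)) f

theorem corelData_isPROP [IsDomain R] [IsPrincipalIdealRing R] : (corelData R).IsPROP := by
  refine PROPData.isPROP_of_rel (S := R) (corelData R)
    (fun {m n} (f : Corel R m n) x y => f.rowRel x y) ?_ ?_ ?_ ?_ ?_
  · intro m n f g
    refine Quotient.inductionOn₂ f g fun f g h => ?_
    exact Quotient.sound (Cospan.iso_of_rowRel f.2 g.2 h)
  · intro n x y
    change (∃ c, c ᵥ* (1 : Matrix _ _ R) = x ∧ c ᵥ* (1 : Matrix _ _ R) = y) ↔ _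
    simp
  · intro l m n f g x z
    refine Quotient.inductionOn₂ f g fun f g => ?_
    exact (Classical.choose_spec (exists_isCorelComp f.1 g.1)).rowRel_iff x z
  · intro m n m' n' f g x y
    refine Quotient.inductionOn₂ f g fun f g => ?_
    exact Cospan.tensor_rowRel f.1 g.1 x y
  · intro m n x y
    change (∃ c, c ᵥ* swapMatrix R m n = x ∧ c ᵥ* (1 : Matrix _ _ R) = y) ↔ _
    simp only [vecMul_swapMatrix, Matrix.vecMul_one, exists_eq_right]
    constructor
    · rintro rfl
      constructor <;> funext i <;> simp
    · rintro ⟨h₁, h₂⟩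
      refine parts_ext (Eq.trans ?_ h₂) (Eq.trans ?_ h₁) <;> funext i <;> simp

variable (R) in
/-- The prop of corelations of matrices over a principal ideal domain. -/
noncomputable def CorelMat [IsDomain R] [IsPrincipalIdealRing R] : PROP.{u} where
  toPROPData := corelData R
  isPROP := corelData_isPROP

end matrices

/-! ### Linear time-invariant behaviours -/

section behaviours

variable {k : Type u} [Field k]

/-- The action of a Laurent polynomial on a biinfinite stream. The indeterminate acts as a one-step
delay, so `∑ aᵢ sⁱ` sends `w` to `t ↦ ∑ aᵢ w (t - i)`. -/
def streamAct (p : k[T;T⁻¹]) (w : ℤ → k) (t : ℤ) : k :=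
  p.coeff.sum fun i a => a * w (t - i)

/-- The linear map `(kᵐ)^ℤ → (kⁿ)^ℤ` induced by an `n × m` matrix of Laurent polynomials. -/
def theta {m n : ℕ} (M : Matrix (Fin n) (Fin m) k[T;T⁻¹]) :
    (ℤ → Fin m → k) →ₗ[k] (ℤ → Fin n → k) where
  toFun w t i := ∑ j, streamAct (M i j) (fun t' => w t' j) t
  map_add' w w' := by
    funext t i
    simp [streamAct, mul_add, Finsupp.sum_add, Finset.sum_add_distrib]
  map_smul' c w := by
    funext t i
    simp [streamAct, Finset.mul_sum, Finsupp.sum, mul_left_comm]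

variable (k) in
/-- The identification of `(kᵐ)^ℤ ⊕ (kⁿ)^ℤ` with `(k^(m+n))^ℤ`. -/
def joinStreams (m n : ℕ) :
    ((ℤ → Fin m → k) × (ℤ → Fin n → k)) ≃ₗ[k] (ℤ → Fin (m + n) → k) where
  toFun w t := Fin.append (w.1 t) (w.2 t)
  invFun w := (fun t => w t ∘ Fin.castAdd n, fun t => w t ∘ Fin.natAdd m)
  map_add' w w' := by
    funext t
    refine parts_ext ?_ ?_ <;> funext i <;> simp
  map_smul' c w := by
    funext t
    refine parts_ext ?_ ?_ <;> funext i <;> simp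
  left_inv w := by
    refine Prod.ext ?_ ?_ <;> funext t i <;> simp
  right_inv w := by
    funext t
    exact append_parts (w t)

/-- The behaviour `{(x, y) | (θ A) x = (θ B) y}` of a cospan `m --A--> d <--B-- n`. -/
def cospanBehaviour {m n d : ℕ} (A : Matrix (Fin d) (Fin m) k[T;T⁻¹])
    (B : Matrix (Fin d) (Fin n) k[T;T⁻¹]) :
    Submodule k ((ℤ → Fin m → k) × (ℤ → Fin n → k)) :=
  LinearMap.eqLocus ((theta A).comp (LinearMap.fst k _ _)) ((theta B).comp (LinearMap.snd k _ _))

variable (k) in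
/-- A complete linear time-invariant discrete behaviour with domain `(kᵐ)^ℤ` and codomain
`(kⁿ)^ℤ`: a linear subspace of `(kᵐ)^ℤ ⊕ (kⁿ)^ℤ` that is closed under all time shifts and contains
each trajectory all of whose restrictions to intervals `[t₀, t₁]` are restrictions of elements. -/
@[ext]
structure LTIBehaviour (m n : ℕ) where
  carrier : Submodule k ((ℤ → Fin m → k) × (ℤ → Fin n → k))
  time_invariant : ∀ w ∈ carrier, ∀ i : ℤ, (fun t => w.1 (t + i), fun t => w.2 (t + i)) ∈ carrier
  complete : ∀ w : (ℤ → Fin m → k) × (ℤ → Fin n → k),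
    (∀ t₀ t₁ : ℤ, t₀ ≤ t₁ →
      ∃ w' ∈ carrier, ∀ t ∈ Set.Icc t₀ t₁, w'.1 t = w.1 t ∧ w'.2 t = w.2 t) →
    w ∈ carrier

section closed

/-- A subspace of `k^I` that contains each point all of whose finite restrictions extend to
elements. -/
def FinClosed {I : Type v} (S : Submodule k (I → k)) : Prop :=
  ∀ w : I → k, (∀ F : Finset I, ∃ w' ∈ S, ∀ i ∈ F, w' i = w i) → w ∈ S

/-- The identification of `k^I` with the dual of the space of finitely supported functions. -/
noncomputable abbrev pairing (k : Type u) [Field k] (I : Type v) :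
    (I → k) ≃ₗ[k] Module.Dual k (I →₀ k) :=
  Finsupp.llift k k k I

theorem pairing_apply {I : Type v} (w : I → k) (f : I →₀ k) :
    pairing k I w f = f.sum fun i a => a * w i := by
  simp [pairing, Finsupp.llift_apply, Finsupp.lift_apply]

theorem FinClosed.exists_annihilator {I : Type v} {S : Submodule k (I → k)} (hS : FinClosed S) :
    ∃ W : Submodule k (I →₀ k), ∀ w, w ∈ S ↔ pairing k I w ∈ W.dualAnnihilator := by
  refine ⟨(S.map (pairing k I).toLinearMap).dualCoannihilator, fun w => ⟨fun hw => ?_, fun hw => ?_⟩⟩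
  · exact (Submodule.le_dualCoannihilator_dualAnnihilator _) (Submodule.mem_map_of_mem hw)
  · classical
    refine hS w fun F => ?_
    by_contra hF
    let r : (I → k) →ₗ[k] (F → k) := LinearMap.funLeft k k Subtype.val
    have hr : r w ∉ S.map r := by
      rintro ⟨w', hw', h⟩
      exact hF ⟨w', hw', fun i hi => congrFun h ⟨i, hi⟩⟩
    obtain ⟨φ, hφ, hφS⟩ := Submodule.exists_le_ker_of_notMem hr
    let f : I →₀ k := ∑ i : F, Finsupp.single i.1 (φ (Pi.single i 1))
    have hf : ∀ v, pairing k I v f = φ (r v) := by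
      intro v
      rw [LinearMap.pi_apply_eq_sum_univ φ (r v), map_sum]
      refine Finset.sum_congr rfl fun i _ => ?_
      rw [pairing_apply, Finsupp.sum_single_index (by simp)]
      simp [r, LinearMap.funLeft_apply, mul_comm]
      refine Or.inl (congrArg φ (funext fun j => ?_))
      simp [Pi.single_apply, eq_comm]
    refine hφ ?_
    rw [← hf]
    refine (Submodule.mem_dualAnnihilator _).1 hw f ?_
    rw [Submodule.mem_dualCoannihilator]
    rintro _ ⟨v, hv, rfl⟩
    exact (hf v).trans (hφS (Submodule.mem_map_of_mem hv))

theorem FinClosed.map_funLeft {I : Type v} {J : Type v} {S : Submodule k (I → k)}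
    (hS : FinClosed S) (g : J → I) : FinClosed (S.map (LinearMap.funLeft k k g)) := by
  obtain ⟨W, hW⟩ := hS.exists_annihilator
  let L : (J →₀ k) →ₗ[k] (I →₀ k) := Finsupp.lmapDomain k k g
  have hL : ∀ w, pairing k J (LinearMap.funLeft k k g w) = L.dualMap (pairing k I w) := by
    intro w
    refine Finsupp.lhom_ext fun i a => ?_
    simp [L]
  have key : ∀ v, v ∈ S.map (LinearMap.funLeft k k g) ↔
      pairing k J v ∈ (LinearMap.ker (W.mkQ.comp L)).dualAnnihilator := by
    intro v
    rw [← LinearMap.range_dualMap_eq_dualAnnihilator_ker]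
    constructor
    · rintro ⟨w, hw, rfl⟩
      have h := (hW w).1 hw
      rw [← Submodule.range_dualMap_mkQ_eq] at h
      obtain ⟨φ, hφ⟩ := h
      refine ⟨φ, ?_⟩
      rw [hL, ← hφ]
      rfl
    · rintro ⟨φ, hφ⟩
      refine ⟨(pairing k I).symm (W.mkQ.dualMap φ), ?_, ?_⟩
      · refine (hW _).2 ?_
        rw [LinearEquiv.apply_symm_apply, ← Submodule.range_dualMap_mkQ_eq]
        exact ⟨φ, rfl⟩
      · refine (pairing k J).injective ?_
        rw [hL, LinearEquiv.apply_symm_apply, ← hφ]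
        rfl
  intro v hv
  rw [key, Submodule.mem_dualAnnihilator]
  intro f hf
  obtain ⟨v', hv', h⟩ := hv f.support
  have := (Submodule.mem_dualAnnihilator _).1 ((key v').1 hv') f hf
  rw [← this, pairing_apply, pairing_apply]
  exact Finset.sum_congr rfl fun i hi => by simp only [h i hi]

end closed

/-- Relational composition of linear relations. -/
def relComp {U V W : Type u} [AddCommGroup U] [AddCommGroup V] [AddCommGroup W] [Module k U]
    [Module k V] [Module k W] (A : Submodule k (U × V)) (B : Submodule k (V × W)) :
    Submodule k (U × W) where
  carrier := {w | ∃ v, (w.1, v) ∈ A ∧ (v, w.2) ∈ B}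
  add_mem' := fun ⟨v, h₁, h₂⟩ ⟨v', h₁', h₂'⟩ => ⟨v + v', A.add_mem h₁ h₁', B.add_mem h₂ h₂'⟩
  zero_mem' := ⟨0, A.zero_mem, B.zero_mem⟩
  smul_mem' := fun c _ ⟨v, h₁, h₂⟩ => ⟨c • v, A.smul_mem c h₁, B.smul_mem c h₂⟩

theorem exists_window {X : Type v} (F : Finset (ℤ × X)) :
    ∃ t₀ t₁ : ℤ, t₀ ≤ t₁ ∧ ∀ i ∈ F, i.1 ∈ Set.Icc t₀ t₁ := by
  refine ⟨-(F.sup fun i => i.1.natAbs : ℕ), (F.sup fun i => i.1.natAbs : ℕ), by omega,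
    fun i hi => ?_⟩
  have := Finset.le_sup (f := fun i : ℤ × X => i.1.natAbs) hi
  simp only [Set.mem_Icc] at *
  omega

/-- Composition of behaviours is relational composition; the result is complete again. -/
def LTIBehaviour.comp {l m n : ℕ} (f : LTIBehaviour k l m) (g : LTIBehaviour k m n) :
    LTIBehaviour k l n where
  carrier := relComp f.carrier g.carrier
  time_invariant := fun _ ⟨v, h₁, h₂⟩ i =>
    ⟨fun t => v (t + i), f.time_invariant _ h₁ i, g.time_invariant _ h₂ i⟩
  complete := by
    intro w hw
    let S : Submodule k (ℤ × (Fin l ⊕ Fin m ⊕ Fin n) → k) :=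
      { carrier := {v | ((fun t i => v (t, .inl i), fun t i => v (t, .inr (.inl i))) ∈ f.carrier) ∧
          (fun t i => v (t, .inr (.inl i)), fun t i => v (t, .inr (.inr i))) ∈ g.carrier}
        add_mem' := fun h h' => ⟨f.carrier.add_mem h.1 h'.1, g.carrier.add_mem h.2 h'.2⟩
        zero_mem' := ⟨f.carrier.zero_mem, g.carrier.zero_mem⟩
        smul_mem' := fun c _ h => ⟨f.carrier.smul_mem c h.1, g.carrier.smul_mem c h.2⟩ }
    have hS : FinClosed S := by
      intro v hv
      constructor
      · refine f.complete _ fun t₀ t₁ _ => ?_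
        obtain ⟨v', hv', h⟩ := hv (Finset.Icc t₀ t₁ ×ˢ Finset.univ)
        refine ⟨_, hv'.1, fun t ht => ⟨funext fun i => h _ ?_, funext fun i => h _ ?_⟩⟩ <;>
          simpa using ht
      · refine g.complete _ fun t₀ t₁ _ => ?_
        obtain ⟨v', hv', h⟩ := hv (Finset.Icc t₀ t₁ ×ˢ Finset.univ)
        refine ⟨_, hv'.2, fun t ht => ⟨funext fun i => h _ ?_, funext fun i => h _ ?_⟩⟩ <;>
          simpa using ht
    let e : ℤ × (Fin l ⊕ Fin n) → ℤ × (Fin l ⊕ Fin m ⊕ Fin n) :=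
      fun p => (p.1, Sum.map id Sum.inr p.2)
    obtain ⟨v, hv, hvw⟩ := hS.map_funLeft e
      (fun p => Sum.elim (w.1 p.1) (w.2 p.1) p.2) (by
        intro F
        obtain ⟨t₀, t₁, h, hF⟩ := exists_window F
        obtain ⟨w', ⟨y, h₁, h₂⟩, hw'⟩ := hw t₀ t₁ h
        refine ⟨_, ⟨fun p => Sum.elim (w'.1 p.1) (Sum.elim (y p.1) (w'.2 p.1)) p.2,
          ⟨h₁, h₂⟩, rfl⟩, ?_⟩
        rintro ⟨t, i | i⟩ hi
        · exact congrFun (hw' t (hF _ hi)).1 i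
        · exact congrFun (hw' t (hF _ hi)).2 i)
    have e₁ : (fun t i => v (t, .inl i)) = w.1 := by
      funext t i
      exact congrFun hvw (t, .inl i)
    have e₂ : (fun t i => v (t, .inr (.inr i))) = w.2 := by
      funext t i
      exact congrFun hvw (t, .inr i)
    refine ⟨fun t i => v (t, .inr (.inl i)), ?_, ?_⟩
    · rw [← e₁]
      exact hv.1
    · rw [← e₂]
      exact hv.2

variable (k) in
/-- The identity behaviour, `{(x, x)}`. -/
def LTIBehaviour.id (n : ℕ) : LTIBehaviour k n n where
  carrier := LinearMap.eqLocus (LinearMap.fst k _ _) (LinearMap.snd k _ _)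
  time_invariant := by
    rintro ⟨x, y⟩ (rfl : x = y) i
    rfl
  complete := by
    rintro ⟨x, y⟩ h
    change x = y
    funext t
    obtain ⟨⟨x', y'⟩, (rfl : x' = y'), h⟩ := h t t le_rfl
    have := h t (by simp)
    exact this.1.symm.trans this.2

/-- The direct sum of behaviours. -/
def LTIBehaviour.tensor {m n m' n' : ℕ} (f : LTIBehaviour k m n) (g : LTIBehaviour k m' n') :
    LTIBehaviour k (m + m') (n + n') where
  carrier :=
    { carrier := {w |
        (fun t => w.1 t ∘ Fin.castAdd m', fun t => w.2 t ∘ Fin.castAdd n') ∈ f.carrier ∧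
          (fun t => w.1 t ∘ Fin.natAdd m, fun t => w.2 t ∘ Fin.natAdd n) ∈ g.carrier}
      add_mem' := fun h h' => ⟨f.carrier.add_mem h.1 h'.1, g.carrier.add_mem h.2 h'.2⟩
      zero_mem' := ⟨f.carrier.zero_mem, g.carrier.zero_mem⟩
      smul_mem' := fun c _ h => ⟨f.carrier.smul_mem c h.1, g.carrier.smul_mem c h.2⟩ }
  time_invariant := fun _ h i => ⟨f.time_invariant _ h.1 i, g.time_invariant _ h.2 i⟩
  complete := by
    intro w hw
    constructor
    · refine f.complete _ fun t₀ t₁ h => ?_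
      obtain ⟨w', hw', h'⟩ := hw t₀ t₁ h
      exact ⟨_, hw'.1, fun t ht => by simp [h' t ht]⟩
    · refine g.complete _ fun t₀ t₁ h => ?_
      obtain ⟨w', hw', h'⟩ := hw t₀ t₁ h
      exact ⟨_, hw'.2, fun t ht => by simp [h' t ht]⟩

variable (k) in
/-- The symmetry, `{((x, y), (y, x))}`. -/
def LTIBehaviour.symm (m n : ℕ) : LTIBehaviour k (m + n) (n + m) where
  carrier :=
    { carrier := {w | ∀ t, w.2 t = w.1 t ∘ finAddFlip}
      add_mem' := fun {a b} h h' t => by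
        change a.2 t + b.2 t = _
        rw [h t, h' t]
        rfl
      zero_mem' := fun t => rfl
      smul_mem' := fun c a h t => by
        change c • a.2 t = _
        rw [h t]
        rfl }
  time_invariant := fun _ h i t => h (t + i)
  complete := by
    intro w hw t
    obtain ⟨w', hw', h⟩ := hw t t le_rfl
    rw [← (h t (by simp)).1, ← (h t (by simp)).2]
    exact hw' t

variable (k) in
/-- The operations of the prop of behaviours: composition is relational and the monoidal product
is the direct sum. -/
def ltiData : PROPData.{u} where
  Hom m n := LTIBehaviour k m n
  id n := LTIBehaviour.id k n
  comp f g := LTIBehaviour.comp f g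
  tensor f g := LTIBehaviour.tensor f g
  symm m n := LTIBehaviour.symm k m n

theorem ltiData_isPROP : (ltiData k).IsPROP := by
  refine PROPData.isPROP_of_rel (S := ℤ → k) (ltiData k)
    (fun {m n} (f : LTIBehaviour k m n) x y => (fun t i => x i t, fun t i => y i t) ∈ f.carrier)
    ?_ ?_ ?_ ?_ ?_
  · intro m n f g h
    refine LTIBehaviour.ext (Submodule.ext fun w => ?_)
    exact h (fun i t => w.1 t i) (fun i t => w.2 t i)
  · intro n x y
    constructor
    · intro h
      funext i t
      exact congrFun (congrFun h t) i
    · rintro rfl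
      rfl
  · intro l m n f g x z
    constructor
    · rintro ⟨y, h₁, h₂⟩
      exact ⟨fun i t => y t i, h₁, h₂⟩
    · rintro ⟨y, h₁, h₂⟩
      exact ⟨_, h₁, h₂⟩
  · intro m n m' n' f g x y
    exact Iff.rfl
  · intro m n x y
    constructor
    · intro h
      constructor <;> funext i t
      · exact (congrFun (h t) _).trans (by simp)
      · exact (congrFun (h t) _).trans (by simp)
    · rintro ⟨h₁, h₂⟩ t
      refine parts_ext (funext fun i => ?_) (funext fun i => ?_)
      · refine (congrFun (congrFun h₁ i) t).trans (by simp)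
      · refine (congrFun (congrFun h₂ i) t).trans (by simp)

variable (k) in
/-- The prop of complete linear time-invariant discrete behaviours. -/
def LTI : PROP.{u} where
  toPROPData := ltiData k
  isPROP := ltiData_isPROP

instance : IsPrincipalIdealRing k[T;T⁻¹] := by
  refine ⟨fun I => ?_⟩
  have h := IsLocalization.map_under (Submonoid.powers (Polynomial.X : Polynomial k)) (k[T;T⁻¹]) I
  obtain ⟨a, ha⟩ := IsPrincipalIdealRing.principal (Ideal.under (Polynomial k) I)
  refine ⟨algebraMap _ _ a, ?_⟩
  rw [← h, ha]
  simp [Ideal.submodule_span_eq, Ideal.map_span]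

end behaviours

end LTISys

/-!
Write `R = k[s, s⁻¹]`. Reading off at time zero the result of applying a row `a ∈ Rᵐ` to a stream
`x ∈ (kᵐ)^ℤ` is a `k`-bilinear pairing that identifies `(kᵐ)^ℤ` with the full algebraic dual of
`Rᵐ` over `k` (`evalZero_surjective`), so that `(kᵐ)^ℤ ⊕ (kⁿ)^ℤ` is the dual of `Rᵐ × Rⁿ`
(`relPairing`). A cospan `(A, B)` has as rows the pairs `(Aᵢ, Bᵢ)`, which span a submodule of
`Rᵐ × Rⁿ`; the isomorphism class of a jointly epic cospan is the same thing as this submodule. Its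
behaviour is the annihilator of the submodule (`mem_cospanBehaviour_iff`): an equation multiplied by
a power of `s` and read at time zero is the same equation read at another time.

The isomorphism is thus the Galois correspondence between `R`-submodules and closed
shift-invariant subspaces of the dual:

* a subspace of a vector space is determined by its annihilator in the full dual, so that the map is
  injective (`Cospan.iso_of_toLTI_eq`);
* a complete behaviour is the annihilator of the equations it satisfies, which form an `R`-module by
  time invariance; as `R` is a principal ideal domain this module is free, and a basis gives a
  jointly epic cospan (`LTIBehaviour.exists_cospan`);
* relational composition of submodules is carried to relational composition of annihilators, because
  a functional that vanishes on the kernel of a linear map factors through it; this provides the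
  intermediate stream (`Cospan.toLTI_comp`).

Identities, symmetries and direct sums are compared directly, and a homomorphism of props that is
bijective on arrows is an isomorphism (`PROPIso.ofBijective`).
-/

namespace LTISys

universe u

variable {k : Type u} [Field k]

/-! ### The module of streams -/

theorem streamAct_zero (w : ℤ → k) : streamAct 0 w = 0 := by
  funext t
  simp [streamAct]

theorem streamAct_add (p q : k[T;T⁻¹]) (w : ℤ → k) :
    streamAct (p + q) w = streamAct p w + streamAct q w := by
  funext t
  simp only [streamAct, AddMonoidAlgebra.coeff_add, Pi.add_apply]
  exact Finsupp.sum_add_index' (by simp) (by simp [add_mul])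

theorem streamAct_smul (c : k) (p : k[T;T⁻¹]) (w : ℤ → k) :
    streamAct (c • p) w = c • streamAct p w := by
  funext t
  simp only [streamAct, AddMonoidAlgebra.coeff_smul, Pi.smul_apply, smul_eq_mul, Finsupp.mul_sum]
  rw [Finsupp.sum_smul_index (by simp)]
  simp only [mul_assoc]

theorem streamAct_single (i : ℤ) (c : k) (w : ℤ → k) (t : ℤ) :
    streamAct (.single i c : k[T;T⁻¹]) w t = c * w (t - i) := by
  rw [streamAct, AddMonoidAlgebra.coeff_single, Finsupp.sum_single_index (zero_mul _)]

theorem streamAct_T (i : ℤ) (w : ℤ → k) (t : ℤ) :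
    streamAct (LaurentPolynomial.T i) w t = w (t - i) := by
  rw [LaurentPolynomial.T, streamAct_single, one_mul]

theorem streamAct_apply_zero (p : k[T;T⁻¹]) (t : ℤ) : streamAct p (0 : ℤ → k) t = 0 := by
  simp [streamAct]

theorem streamAct_apply_add (p : k[T;T⁻¹]) (v w : ℤ → k) :
    streamAct p (v + w) = streamAct p v + streamAct p w := by
  funext t
  simp [streamAct, mul_add, Finsupp.sum_add]

theorem streamAct_apply_sum {ι : Type*} (s : Finset ι) (p : k[T;T⁻¹]) (w : ι → ℤ → k) :
    streamAct p (∑ i ∈ s, w i) = ∑ i ∈ s, streamAct p (w i) := by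
  classical
  induction s using Finset.induction_on with
  | empty => funext t; simpa using streamAct_apply_zero p t
  | insert i s hi ih => rw [Finset.sum_insert hi, Finset.sum_insert hi, streamAct_apply_add, ih]

theorem streamAct_mul (p q : k[T;T⁻¹]) (w : ℤ → k) :
    streamAct (p * q) w = streamAct p (streamAct q w) := by
  induction p using AddMonoidAlgebra.induction_linear with
  | zero => rw [zero_mul, streamAct_zero, streamAct_zero]
  | add p p' hp hp' => rw [add_mul, streamAct_add, streamAct_add, hp, hp']
  | single i a =>
    induction q using AddMonoidAlgebra.induction_linear with
    | zero =>
      rw [mul_zero, streamAct_zero]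
      funext t
      rw [streamAct_apply_zero]; rfl
    | add q q' hq hq' => rw [mul_add, streamAct_add, streamAct_add, streamAct_apply_add, hq, hq']
    | single j b =>
      funext t
      rw [AddMonoidAlgebra.single_mul_single, streamAct_single, streamAct_single, streamAct_single,
        mul_assoc, sub_sub]

/-- The scalar equation operator `x ↦ ∑ⱼ aⱼ xⱼ` of a row `a` of Laurent polynomials; the rows of
`θ M` are the operators of the rows of `M`. -/
def rowAct {m : ℕ} (a : Fin m → k[T;T⁻¹]) (x : ℤ → Fin m → k) : ℤ → k :=
  ∑ j, streamAct (a j) (fun t => x t j)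

theorem theta_apply {m n : ℕ} (M : Matrix (Fin n) (Fin m) k[T;T⁻¹]) (x : ℤ → Fin m → k) (t : ℤ)
    (i : Fin n) : theta M x t i = rowAct (M i) x t := by
  simp [theta, rowAct]

theorem rowAct_add {m : ℕ} (a b : Fin m → k[T;T⁻¹]) (x : ℤ → Fin m → k) :
    rowAct (a + b) x = rowAct a x + rowAct b x := by
  simp only [rowAct, Pi.add_apply, streamAct_add, Finset.sum_add_distrib]

theorem rowAct_zero {m : ℕ} (x : ℤ → Fin m → k) : rowAct 0 x = 0 := by
  simp [rowAct, streamAct_zero]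

theorem rowAct_smul {m : ℕ} (p : k[T;T⁻¹]) (a : Fin m → k[T;T⁻¹]) (x : ℤ → Fin m → k) :
    rowAct (p • a) x = streamAct p (rowAct a x) := by
  simp only [rowAct, Pi.smul_apply, smul_eq_mul, streamAct_mul, streamAct_apply_sum]

theorem rowAct_sum {m : ℕ} {ι : Type*} (s : Finset ι) (a : ι → Fin m → k[T;T⁻¹])
    (x : ℤ → Fin m → k) : rowAct (∑ i ∈ s, a i) x = ∑ i ∈ s, rowAct (a i) x := by
  classical
  induction s using Finset.induction_on with
  | empty => exact rowAct_zero x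
  | insert i s hi ih => rw [Finset.sum_insert hi, Finset.sum_insert hi, rowAct_add, ih]

theorem rowAct_single {m : ℕ} (j : Fin m) (p : k[T;T⁻¹]) (x : ℤ → Fin m → k) :
    rowAct (Pi.single j p) x = streamAct p (fun t => x t j) := by
  rw [rowAct, Finset.sum_eq_single j]
  · rw [Pi.single_eq_same]
  · intro l _ hl
    rw [Pi.single_eq_of_ne hl, streamAct_zero]
  · simp

theorem rowAct_vecMul {m d : ℕ} (c : Fin d → k[T;T⁻¹]) (A : Matrix (Fin d) (Fin m) k[T;T⁻¹])
    (x : ℤ → Fin m → k) : rowAct (c ᵥ* A) x = rowAct c (theta A x) := by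
  rw [Matrix.vecMul_eq_sum, rowAct_sum, rowAct]
  refine Finset.sum_congr rfl fun i _ => ?_
  rw [rowAct_smul]
  congr 1
  funext t
  exact (theta_apply A x t i).symm

theorem rowAct_T_smul_zero {m : ℕ} (t : ℤ) (a : Fin m → k[T;T⁻¹]) (x : ℤ → Fin m → k) :
    rowAct ((LaurentPolynomial.T (-t) : k[T;T⁻¹]) • a) x 0 = rowAct a x t := by
  rw [rowAct_smul, streamAct_T, zero_sub, neg_neg]

theorem rowAct_shift {m : ℕ} (a : Fin m → k[T;T⁻¹]) (x : ℤ → Fin m → k) (i t : ℤ) :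
    rowAct a (fun t => x (t + i)) t = rowAct a x (t + i) := by
  simp only [rowAct, Finset.sum_apply, streamAct]
  refine Finset.sum_congr rfl fun j _ => Finsupp.sum_congr fun l _ => ?_
  rw [sub_add_eq_add_sub]

/-- Each value of `rowAct a x` depends on finitely many values of `x`. -/
theorem exists_finset_rowAct_congr {m : ℕ} (a : Fin m → k[T;T⁻¹]) (t : ℤ) :
    ∃ F : Finset ℤ, ∀ x x' : ℤ → Fin m → k, (∀ i ∈ F, x i = x' i) →
      rowAct a x t = rowAct a x' t := by
  refine ⟨Finset.univ.biUnion fun j => (a j).coeff.support.image (t - ·), fun x x' h => ?_⟩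
  simp only [rowAct, Finset.sum_apply, streamAct]
  refine Finset.sum_congr rfl fun j _ => Finsupp.sum_congr fun l hl => ?_
  rw [h]
  exact Finset.mem_biUnion.2 ⟨j, Finset.mem_univ j, Finset.mem_image_of_mem _ hl⟩

theorem streamAct_one (w : ℤ → k) : streamAct 1 w = w := by
  funext t
  rw [← LaurentPolynomial.T_zero, streamAct_T, sub_zero]

theorem theta_one {n : ℕ} (x : ℤ → Fin n → k) :
    theta (1 : Matrix (Fin n) (Fin n) k[T;T⁻¹]) x = x := by
  funext t i
  rw [theta_apply, rowAct, Finset.sum_apply, Finset.sum_eq_single i]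
  · rw [Matrix.one_apply_eq, streamAct_one]
  · intro j _ hj
    rw [Matrix.one_apply_ne hj.symm, streamAct_zero, Pi.zero_apply]
  · simp

theorem theta_swapMatrix {m n : ℕ} (x : ℤ → Fin (m + n) → k) (t : ℤ) :
    theta (swapMatrix k[T;T⁻¹] m n) x t = x t ∘ finAddFlip := by
  funext i
  have h (j : Fin (m + n)) : streamAct (swapMatrix k[T;T⁻¹] m n i j) (fun t => x t j) t =
      swapMatrix k m n i j * x t j := by
    by_cases hij : i = finAddFlip j <;> simp [swapMatrix, hij, streamAct_one, streamAct_zero]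
  rw [← swapMatrix_mulVec, theta_apply, rowAct, Finset.sum_apply]
  simp only [h]
  rfl

theorem theta_blockDiag {m n m' n' : ℕ} (A : Matrix (Fin n) (Fin m) k[T;T⁻¹])
    (B : Matrix (Fin n') (Fin m') k[T;T⁻¹]) (x : ℤ → Fin (m + m') → k) (t : ℤ) :
    theta (blockDiag A B) x t =
      Fin.append (theta A (fun t => x t ∘ Fin.castAdd m') t)
        (theta B (fun t => x t ∘ Fin.natAdd m) t) := by
  refine parts_ext ?_ ?_ <;> funext i <;>
    simp [theta, blockDiag, Fin.sum_univ_add, streamAct_zero]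

theorem theta_copair {m n d : ℕ} (A : Matrix (Fin d) (Fin m) k[T;T⁻¹])
    (B : Matrix (Fin d) (Fin n) k[T;T⁻¹]) (w : (ℤ → Fin m → k) × (ℤ → Fin n → k)) :
    theta (copair A B) (joinStreams k m n w) = theta A w.1 + theta B w.2 := by
  funext t i
  simp [theta, copair, joinStreams, Fin.sum_univ_add]

theorem theta_neg {m n : ℕ} (M : Matrix (Fin n) (Fin m) k[T;T⁻¹]) (x : ℤ → Fin m → k) :
    theta (-M) x = -theta M x := by
  funext t i
  have h (p : k[T;T⁻¹]) (w : ℤ → k) : streamAct (-p) w = -streamAct p w := by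
    simpa using streamAct_smul (-1) p w
  simp [theta, h]

theorem cospanBehaviour_eq_ker {m n d : ℕ} (A : Matrix (Fin d) (Fin m) k[T;T⁻¹])
    (B : Matrix (Fin d) (Fin n) k[T;T⁻¹]) :
    cospanBehaviour A B = Submodule.comap (joinStreams k m n).toLinearMap
      (LinearMap.ker (theta (copair A (-B)))) := by
  ext w
  simp [cospanBehaviour, theta_copair, theta_neg, add_neg_eq_zero]

/-! ### The duality between streams and rows -/

/-- Evaluating `rowAct a x` at time zero makes a stream `x` a `k`-linear functional on rows. All
functionals arise in this way, so streams are the full `k`-dual of the rows. -/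
noncomputable def evalZero {m : ℕ} (x : ℤ → Fin m → k) : Module.Dual k (Fin m → k[T;T⁻¹]) where
  toFun a := rowAct a x 0
  map_add' a b := by rw [rowAct_add, Pi.add_apply]
  map_smul' c a := by
    simp [rowAct, streamAct_smul, Finset.mul_sum]

theorem evalZero_surjective {m : ℕ} : Function.Surjective (evalZero (k := k) (m := m)) := by
  intro φ
  -- The coefficient of `sⁱ` is paired with the value at time `-i`, whence the sign.
  refine ⟨fun t j => φ (Pi.single j (LaurentPolynomial.T (-t))), LinearMap.pi_ext fun j p => ?_⟩
  induction p using AddMonoidAlgebra.induction_linear with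
  | zero => simp
  | add p q hp hq => rw [Pi.single_add, map_add, map_add, hp, hq]
  | single i c =>
    change rowAct _ _ 0 = _
    rw [rowAct_single, streamAct_single, zero_sub, neg_neg, ← smul_eq_mul, ← map_smul,
      ← Pi.single_smul, LaurentPolynomial.T, AddMonoidAlgebra.smul_single, smul_eq_mul, mul_one]

/-- The pairing of a trajectory `(x, y)` with a pair of rows `(a, b)`: the defect at time zero of
the equation `a x = b y`. -/
noncomputable def relPairing {m n : ℕ} (w : (ℤ → Fin m → k) × (ℤ → Fin n → k)) :
    Module.Dual k ((Fin m → k[T;T⁻¹]) × (Fin n → k[T;T⁻¹])) :=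
  (evalZero w.1).coprod (-evalZero w.2)

theorem relPairing_eq_zero {m n : ℕ} {w : (ℤ → Fin m → k) × (ℤ → Fin n → k)}
    {p : (Fin m → k[T;T⁻¹]) × (Fin n → k[T;T⁻¹])} :
    relPairing w p = 0 ↔ rowAct p.1 w.1 0 = rowAct p.2 w.2 0 := by
  change rowAct p.1 w.1 0 + -rowAct p.2 w.2 0 = 0 ↔ _
  rw [add_neg_eq_zero]

theorem relPairing_surjective {m n : ℕ} :
    Function.Surjective (relPairing (k := k) (m := m) (n := n)) := by
  intro φ
  obtain ⟨x, hx⟩ := evalZero_surjective (φ.comp (LinearMap.inl k _ _))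
  obtain ⟨y, hy⟩ := evalZero_surjective (-φ.comp (LinearMap.inr k _ _))
  refine ⟨(x, y), ?_⟩
  rw [relPairing, hx, hy, neg_neg, ← LinearMap.comp_coprod, LinearMap.coprod_inl_inr,
    LinearMap.comp_id]

/-- The behaviour of a cospan depends only on its row relation, of which it is the annihilator. -/
theorem mem_cospanBehaviour_iff {m n : ℕ} (f : Cospan k[T;T⁻¹] m n)
    (w : (ℤ → Fin m → k) × (ℤ → Fin n → k)) :
    w ∈ cospanBehaviour f.left f.right ↔ ∀ a b, f.rowRel a b → relPairing w (a, b) = 0 := by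
  simp only [relPairing_eq_zero]
  constructor
  · rintro (h : theta f.left w.1 = theta f.right w.2) _ _ ⟨c, rfl, rfl⟩
    rw [rowAct_vecMul, rowAct_vecMul, h]
  · intro h
    change theta f.left w.1 = theta f.right w.2
    funext t i
    rw [theta_apply, theta_apply, ← rowAct_T_smul_zero t (f.left i),
      ← rowAct_T_smul_zero t (f.right i)]
    obtain ⟨c, h₁, h₂⟩ := f.row_rowRel i
    exact h _ _ ⟨(LaurentPolynomial.T (-t) : k[T;T⁻¹]) • c, by rw [Matrix.smul_vecMul, h₁],
      by rw [Matrix.smul_vecMul, h₂]⟩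

/-- The behaviour of a cospan, as an arrow of the prop of behaviours. -/
noncomputable def Cospan.toLTI {m n : ℕ} (f : Cospan k[T;T⁻¹] m n) : LTIBehaviour k m n where
  carrier := cospanBehaviour f.left f.right
  time_invariant := by
    rintro w (h : theta f.left w.1 = theta f.right w.2) i
    change theta f.left (fun t => w.1 (t + i)) = theta f.right (fun t => w.2 (t + i))
    funext t j
    rw [theta_apply, theta_apply, rowAct_shift, rowAct_shift, ← theta_apply, ← theta_apply, h]
  complete := by
    intro w hw
    change theta f.left w.1 = theta f.right w.2
    funext t j
    obtain ⟨F, hF⟩ := exists_finset_rowAct_congr (f.left j) t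
    obtain ⟨G, hG⟩ := exists_finset_rowAct_congr (f.right j) t
    obtain ⟨t₀, t₁, h, hFG⟩ := exists_window ((F ∪ G) ×ˢ {()})
    obtain ⟨w', h', hw'⟩ := hw t₀ t₁ h
    replace h' : theta f.left w'.1 = theta f.right w'.2 := h'
    rw [theta_apply, theta_apply,
      ← hF w'.1 w.1 fun i hi => (hw' i (hFG (i, ()) (by simp [hi]))).1,
      ← hG w'.2 w.2 fun i hi => (hw' i (hFG (i, ()) (by simp [hi]))).2,
      ← theta_apply, ← theta_apply, h']

/-- A submodule of rows is determined by its annihilator: a row outside it is separated from it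
by a functional, hence by a trajectory. -/
theorem Cospan.iso_of_toLTI_eq {m n : ℕ} {f g : Cospan k[T;T⁻¹] m n} (hf : f.JointlyEpic)
    (hg : g.JointlyEpic) (h : f.toLTI = g.toLTI) : f.Iso g := by
  have key : ∀ {f g : Cospan k[T;T⁻¹] m n}, f.toLTI = g.toLTI →
      ∀ a b, f.rowRel a b → g.rowRel a b := by
    intro f g h a b hab
    by_contra hg
    let N : Submodule k[T;T⁻¹] ((Fin m → k[T;T⁻¹]) × (Fin n → k[T;T⁻¹])) :=
      LinearMap.range ((Matrix.vecMulLinear g.left).prod (Matrix.vecMulLinear g.right))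
    have hN : ∀ a b, (a, b) ∈ N.restrictScalars k ↔ g.rowRel a b := by
      intro a b
      simp [N, Cospan.rowRel]
    obtain ⟨φ, hφ, hφN⟩ := Submodule.exists_le_ker_of_notMem (mt (hN a b).1 hg)
    obtain ⟨w, rfl⟩ := relPairing_surjective φ
    have hw : w ∈ g.toLTI.carrier :=
      (mem_cospanBehaviour_iff g w).2 fun a b hab => hφN ((hN a b).2 hab)
    rw [← h] at hw
    exact hφ ((mem_cospanBehaviour_iff f w).1 hw a b hab)
  exact iso_of_rowRel hf hg fun a b => ⟨key h a b, key h.symm a b⟩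

/-- By completeness, a trajectory outside a behaviour violates some scalar equation that holds, at
time zero, on the whole behaviour. -/
theorem LTIBehaviour.exists_relPairing_ne_zero {m n : ℕ} (f : LTIBehaviour k m n)
    {w : (ℤ → Fin m → k) × (ℤ → Fin n → k)} (hw : w ∉ f.carrier) :
    ∃ p, (∀ v ∈ f.carrier, relPairing v p = 0) ∧ relPairing w p ≠ 0 := by
  -- `r` and `r'` are the two directions of the identification of trajectories with `k^I`, where
  -- `I = ℤ × (Fin m ⊕ Fin n)`.
  let r : (ℤ × (Fin m ⊕ Fin n) → k) →ₗ[k] (ℤ → Fin m → k) × (ℤ → Fin n → k) :=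
    { toFun := fun v => (fun t i => v (t, .inl i), fun t i => v (t, .inr i))
      map_add' := fun _ _ => rfl
      map_smul' := fun _ _ => rfl }
  let r' : (ℤ → Fin m → k) × (ℤ → Fin n → k) → ℤ × (Fin m ⊕ Fin n) → k :=
    fun v p => Sum.elim (v.1 p.1) (v.2 p.1) p.2
  have hS : FinClosed (f.carrier.comap r) := by
    intro v hv
    refine f.complete _ fun t₀ t₁ _ => ?_
    obtain ⟨v', hv', h⟩ := hv (Finset.Icc t₀ t₁ ×ˢ Finset.univ)
    refine ⟨_, hv', fun t ht => ⟨funext fun i => h _ ?_, funext fun i => h _ ?_⟩⟩ <;>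
      simpa using ht
  obtain ⟨W, hW⟩ := hS.exists_annihilator
  -- `E` turns a finitely supported family of coefficients into the rows of a scalar equation.
  let E : (ℤ × (Fin m ⊕ Fin n) →₀ k) →ₗ[k] (Fin m → k[T;T⁻¹]) × (Fin n → k[T;T⁻¹]) :=
    Finsupp.linearCombination k fun p =>
      Sum.elim (fun i => (Pi.single i (LaurentPolynomial.T (-p.1) : k[T;T⁻¹]), 0))
        (fun i => (0, -Pi.single i (LaurentPolynomial.T (-p.1) : k[T;T⁻¹]))) p.2
  have hsingle : ∀ {l : ℕ} (x : ℤ → Fin l → k) (t : ℤ) (i : Fin l),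
      evalZero x (Pi.single i (LaurentPolynomial.T (-t))) = x t i := by
    intro l x t i
    change rowAct _ _ 0 = _
    rw [rowAct_single, streamAct_T, zero_sub, neg_neg]
  have hE : ∀ v, (relPairing v).comp E = pairing k _ (r' v) := by
    intro v
    refine Finsupp.lhom_ext fun p c => ?_
    rcases p with ⟨t, i | i⟩ <;> simp [E, r', relPairing, hsingle]
  have hw' : r' w ∉ f.carrier.comap r := hw
  rw [hW, Submodule.mem_dualAnnihilator] at hw'
  push Not at hw'
  obtain ⟨c, hc, hne⟩ := hw'
  refine ⟨E c, fun v hv => ?_, ?_⟩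
  · exact (LinearMap.congr_fun (hE v) c).trans
      ((Submodule.mem_dualAnnihilator _).1 ((hW (r' v)).1 hv) c hc)
  · exact fun h => hne ((LinearMap.congr_fun (hE w) c).symm.trans h)

/-- The module of the scalar equations `a x = b y` that hold on a behaviour. -/
noncomputable def LTIBehaviour.equations {m n : ℕ} (f : LTIBehaviour k m n) :
    Submodule k[T;T⁻¹] ((Fin m → k[T;T⁻¹]) × (Fin n → k[T;T⁻¹])) where
  carrier := {p | ∀ v ∈ f.carrier, rowAct p.1 v.1 = rowAct p.2 v.2}
  add_mem' := fun {p q} hp hq v hv => by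
    rw [Prod.fst_add, Prod.snd_add, rowAct_add, rowAct_add, hp v hv, hq v hv]
  zero_mem' := fun v _ => by rw [Prod.fst_zero, Prod.snd_zero, rowAct_zero, rowAct_zero]
  smul_mem' := fun c p hp v hv => by
    rw [Prod.smul_fst, Prod.smul_snd, rowAct_smul, rowAct_smul, hp v hv]

/-- By time invariance, an equation that holds at time zero on a behaviour holds at all times. -/
theorem LTIBehaviour.mem_equations_iff {m n : ℕ} (f : LTIBehaviour k m n)
    (p : (Fin m → k[T;T⁻¹]) × (Fin n → k[T;T⁻¹])) :
    p ∈ f.equations ↔ ∀ v ∈ f.carrier, relPairing v p = 0 := by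
  simp only [relPairing_eq_zero]
  refine ⟨fun h v hv => congrFun (h v hv) 0, fun h v hv => funext fun t => ?_⟩
  have := h _ (f.time_invariant v hv t)
  rwa [rowAct_shift, rowAct_shift, zero_add] at this

/-- Every behaviour is the annihilator of the module of its equations, and therefore the behaviour
of a cospan whose rows form a basis of that module. -/
theorem LTIBehaviour.exists_cospan {m n : ℕ} (f : LTIBehaviour k m n) :
    ∃ g : Cospan k[T;T⁻¹] m n, g.JointlyEpic ∧ g.toLTI = f := by
  obtain ⟨g, hg, h⟩ := exists_cospan_of_submodule f.equations
  refine ⟨g, hg, LTIBehaviour.ext (Submodule.ext fun w => ?_)⟩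
  refine (mem_cospanBehaviour_iff g w).trans ⟨fun hw => ?_, fun hw a b hab => ?_⟩
  · by_contra hwf
    obtain ⟨p, hp, hne⟩ := f.exists_relPairing_ne_zero hwf
    exact hne (hw p.1 p.2 ((h _ _).2 ((f.mem_equations_iff p).2 hp)))
  · exact (f.mem_equations_iff _).1 ((h a b).1 hab) w hw

/-! ### Functoriality -/

/-- If `h` has as rows the relational composite of the rows of `f` and `g`, then its behaviour is
the relational composite of their behaviours. An intermediate stream is found by factoring through
the middle rows the functional given by the two outer streams. -/
theorem Cospan.toLTI_comp {l m n : ℕ} {f : Cospan k[T;T⁻¹] l m} {g : Cospan k[T;T⁻¹] m n}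
    {h : Cospan k[T;T⁻¹] l n}
    (H : ∀ a c, h.rowRel a c ↔ ∃ b, f.rowRel a b ∧ g.rowRel b c) :
    h.toLTI = f.toLTI.comp g.toLTI := by
  refine LTIBehaviour.ext (Submodule.ext fun w => ?_)
  refine (mem_cospanBehaviour_iff h w).trans ⟨fun hw => ?_, ?_⟩
  · let L : ((Fin f.apex → k[T;T⁻¹]) × (Fin g.apex → k[T;T⁻¹])) →ₗ[k] (Fin m → k[T;T⁻¹]) :=
      ((Matrix.vecMulLinear f.right).coprod (-Matrix.vecMulLinear g.left)).restrictScalars k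
    let ψ : Module.Dual k ((Fin f.apex → k[T;T⁻¹]) × (Fin g.apex → k[T;T⁻¹])) :=
      ((evalZero w.1).comp ((Matrix.vecMulLinear f.left).restrictScalars k)).coprod
        (-(evalZero w.2).comp ((Matrix.vecMulLinear g.right).restrictScalars k))
    have hψ : ψ ∈ (LinearMap.ker L).dualAnnihilator := by
      rw [Submodule.mem_dualAnnihilator]
      rintro ⟨c, d⟩ (hcd : c ᵥ* f.right + -(d ᵥ* g.left) = 0)
      rw [add_neg_eq_zero] at hcd
      exact hw _ _ ((H _ _).2 ⟨_, ⟨c, rfl, rfl⟩, d, hcd.symm, rfl⟩)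
    rw [← LinearMap.range_dualMap_eq_dualAnnihilator_ker] at hψ
    obtain ⟨φ, hφ⟩ := hψ
    obtain ⟨y, rfl⟩ := evalZero_surjective φ
    refine ⟨y, (mem_cospanBehaviour_iff f _).2 ?_, (mem_cospanBehaviour_iff g _).2 ?_⟩
    · rintro _ _ ⟨c, rfl, rfl⟩
      have h₁ := LinearMap.congr_fun hφ (c, 0)
      simp only [L, ψ, LinearMap.dualMap_apply, LinearMap.coprod_apply,
        LinearMap.restrictScalars_apply, map_zero, add_zero, LinearMap.comp_apply] at h₁
      exact relPairing_eq_zero.2 h₁.symm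
    · rintro _ _ ⟨d, rfl, rfl⟩
      have h₁ := LinearMap.congr_fun hφ (0, d)
      simp only [L, ψ, LinearMap.dualMap_apply, LinearMap.coprod_apply,
        LinearMap.restrictScalars_apply, map_zero, zero_add, LinearMap.comp_apply,
        LinearMap.neg_apply, map_neg, neg_inj] at h₁
      exact relPairing_eq_zero.2 h₁
  · rintro ⟨y, h₁, h₂⟩ a c hac
    obtain ⟨b, hab, hbc⟩ := (H a c).1 hac
    have e₁ := relPairing_eq_zero.1 ((mem_cospanBehaviour_iff f _).1 h₁ a b hab)
    have e₂ := relPairing_eq_zero.1 ((mem_cospanBehaviour_iff g _).1 h₂ b c hbc)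
    exact relPairing_eq_zero.2 (e₁.trans e₂)

theorem Cospan.toLTI_tensor {m n m' n' : ℕ} (f : Cospan k[T;T⁻¹] m n)
    (g : Cospan k[T;T⁻¹] m' n') : (f.tensor g).toLTI = f.toLTI.tensor g.toLTI := by
  refine LTIBehaviour.ext (Submodule.ext fun w => ?_)
  change theta (blockDiag f.left g.left) w.1 = theta (blockDiag f.right g.right) w.2 ↔
    theta f.left (fun t => w.1 t ∘ Fin.castAdd m') =
        theta f.right (fun t => w.2 t ∘ Fin.castAdd n') ∧
      theta g.left (fun t => w.1 t ∘ Fin.natAdd m) = theta g.right (fun t => w.2 t ∘ Fin.natAdd n)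
  constructor
  · refine fun h => ⟨funext fun t => ?_, funext fun t => ?_⟩ <;>
      have h := congrFun h t <;>
      rw [theta_blockDiag, theta_blockDiag] at h
    · simpa only [append_castAdd] using congrArg (· ∘ Fin.castAdd g.apex) h
    · simpa only [append_natAdd] using congrArg (· ∘ Fin.natAdd f.apex) h
  · rintro ⟨h₁, h₂⟩
    funext t
    rw [theta_blockDiag, theta_blockDiag, h₁, h₂]

theorem Cospan.toLTI_id (n : ℕ) :
    (⟨n, 1, 1⟩ : Cospan k[T;T⁻¹] n n).toLTI = LTIBehaviour.id k n := by
  refine LTIBehaviour.ext (Submodule.ext fun w => ?_)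
  change theta (1 : Matrix (Fin n) (Fin n) k[T;T⁻¹]) w.1 = theta 1 w.2 ↔ w.1 = w.2
  rw [theta_one, theta_one]

theorem Cospan.toLTI_symm (m n : ℕ) :
    (⟨n + m, swapMatrix _ m n, 1⟩ : Cospan k[T;T⁻¹] (m + n) (n + m)).toLTI =
      LTIBehaviour.symm k m n := by
  refine LTIBehaviour.ext (Submodule.ext fun w => ?_)
  change theta (swapMatrix k[T;T⁻¹] m n) w.1 = theta 1 w.2 ↔ ∀ t, w.2 t = w.1 t ∘ finAddFlip
  rw [theta_one, eq_comm, funext_iff]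
  simp only [theta_swapMatrix]

/-- The behaviour of a corelation. -/
noncomputable def Corel.toLTI {m n : ℕ} : Corel k[T;T⁻¹] m n → LTIBehaviour k m n :=
  Quotient.lift (fun f => f.1.toLTI) fun f g h => LTIBehaviour.ext <| Submodule.ext fun w => by
    refine (mem_cospanBehaviour_iff f.1 w).trans (Iff.trans ?_ (mem_cospanBehaviour_iff g.1 w).symm)
    simp only [Cospan.Iso.rowRel_iff h]

theorem Corel.toLTI_injective {m n : ℕ} :
    Function.Injective (Corel.toLTI (k := k) (m := m) (n := n)) := fun f g =>
  Quotient.inductionOn₂ f g fun f g h => Quotient.sound (Cospan.iso_of_toLTI_eq f.2 g.2 h)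

theorem Corel.toLTI_surjective {m n : ℕ} :
    Function.Surjective (Corel.toLTI (k := k) (m := m) (n := n)) := fun f =>
  let ⟨g, hg, h⟩ := f.exists_cospan
  ⟨Quotient.mk _ ⟨g, hg⟩, h⟩

variable (k) in
/-- The homomorphism of props that sends a corelation to its behaviour. -/
noncomputable def corelToLTI : PROPHom (CorelMat k[T;T⁻¹]) (LTI k) where
  map := Corel.toLTI
  map_id := Cospan.toLTI_id
  map_comp := fun f g => Quotient.inductionOn₂ f g fun f g =>
    Cospan.toLTI_comp (Classical.choose_spec (exists_isCorelComp f.1 g.1)).rowRel_iff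
  map_tensor := fun f g => Quotient.inductionOn₂ f g fun f g => Cospan.toLTI_tensor f.1 g.1
  map_symm := Cospan.toLTI_symm

/-- A homomorphism of props that is bijective on arrows is an isomorphism. -/
noncomputable def PROPIso.ofBijective {P : PROP.{u}} {Q : PROP.{u}} (F : PROPHom P Q)
    (inj : ∀ m n : ℕ, Function.Injective (F.map (m := m) (n := n)))
    (surj : ∀ m n : ℕ, Function.Surjective (F.map (m := m) (n := n))) : PROPIso P Q where
  hom := F
  inv :=
    { map := fun {m n} => Function.surjInv (surj m n)
      map_id := fun n => inj _ _ (by simp only [Function.surjInv_eq, F.map_id])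
      map_comp := fun f g => inj _ _ (by simp only [Function.surjInv_eq, F.map_comp])
      map_tensor := fun f g => inj _ _ (by simp only [Function.surjInv_eq, F.map_tensor])
      map_symm := fun m n => inj _ _ (by simp only [Function.surjInv_eq, F.map_symm]) }
  hom_inv := fun f => inj _ _ (Function.surjInv_eq (surj _ _) _)
  inv_hom := fun g => Function.surjInv_eq (surj _ _) g

end LTISys

theorem mainTheorem1 {k : Type*} [Field k] :
    ∃ Φ : LTISys.PROPIso (LTISys.CorelMat k[T;T⁻¹]) (LTISys.LTI k),
      ∀ {m n d : ℕ} (A : Matrix (Fin d) (Fin m) k[T;T⁻¹]) (B : Matrix (Fin d) (Fin n) k[T;T⁻¹])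
        (h : LTISys.IsEpi (LTISys.copair A B)),
        LTISys.LTIBehaviour.carrier (Φ.hom.map (LTISys.Corel.mk A B h)) =
            LTISys.cospanBehaviour A B ∧
          LTISys.cospanBehaviour A B =
            Submodule.comap (LTISys.joinStreams k m n).toLinearMap
              (LinearMap.ker (LTISys.theta (LTISys.copair A (-B)))) :=
  ⟨.ofBijective (LTISys.corelToLTI k) (fun _ _ => LTISys.Corel.toLTI_injective)
    fun _ _ => LTISys.Corel.toLTI_surjective,
    fun A B _ => ⟨rfl, LTISys.cospanBehaviour_eq_ker A B⟩⟩
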